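/- Let $b>1$ and $c>0$. For $k\in\left(0,\frac{c}{b+1}\right)$ there is a unique non-constant $\phi=\phi_k\in C^\infty(\mathbb R)$ such that $$-(c-\phi)(\phi'''-\phi')+b\,\phi'(\phi''-\phi)=0 \ \text{ on } \mathbb R,\qquad \phi'(0)=0,\qquad \phi(x)\to k \ \text{ as } |x|\to\infty$$ (the profile of the smooth solitary wave $u(t,x)=\phi(x-ct)$ of the $b$-Camassa--Holm equation $u_t-u_{txx}+(b+1)uu_x=b\,u_xu_{xx}+u\,u_{xxx}$ on the background $k$). It satisfies $0<\phi_k<c$, and the integral $$Q(\phi_k):=\int_{\mathbb R}\left[b\,\frac{c-k}{c-\phi_k(x)}-\left(\frac{c-k}{c-\phi_k(x)}\right)^{b}-b+1\right]dx$$ converges absolutely. The map $k\mapsto Q(\phi_k)$ is strictly increasing in the limits $k\to0$ and $k\to\frac{c}{b+1}$: there are $\delta_1,\delta_2\in\left(0,\frac{c}{b+1}\right)$ such that it is strictly increasing on $(0,\delta_1)$ and on $\left(\delta_2,\frac{c}{b+1}\right)$. Moreover, let $\gamma:=\frac{c-k(b+1)}{c-k}$, which maps $\left(0,\frac{c}{b+1}\right)$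 decreasingly onto $(0,1)$ with inverse $k=\frac{c(1-\gamma)}{b+1-\gamma}$, and regard $Q$ as a function of $\gamma\in(0,1)$. Then $Q$ is differentiable with $\frac{dQ}{d\gamma}<0$ for all $\gamma$ sufficiently close to $0$ and for all $\gamma$ sufficiently close to $1$, and $Q\to-\infty$ as $\gamma\to1$ (that is, as $k\to0$). -/

import Mathlib

open Filter Topology Set MeasureTheory
open scoped ContDiff

noncomputable section

/-- `φ` is the profile of a smooth solitary wave `u(t,x) = φ(x - c t)` of the `b`-Camassa-Holm equation
`u_t - u_{txx} + (b+1) u u_x = b u_x u_{xx} + u u_{xxx}` on the constant background `k`,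
centred so that `φ'(0) = 0`. The last field excludes the constant solution `φ = k`. -/
structure IsSolitaryWave (b c k : ℝ) (φ : ℝ → ℝ) : Prop where
  smooth : ContDiff ℝ ∞ φ
  ode : ∀ x, -(c - φ x) * (iteratedDeriv 3 φ x - deriv φ x)
    + b * deriv φ x * (iteratedDeriv 2 φ x - φ x) = 0
  centred : deriv φ 0 = 0
  tendsto_atTop : Tendsto φ atTop (𝓝 k)
  tendsto_atBot : Tendsto φ atBot (𝓝 k)
  nonconstant : ∃ x, φ x ≠ k

/-- The solitary wave profile with speed `c` on the background `k`. It is meaningful where exactly one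
profile exists; the main theorem asserts this for all `k` in `(0, c / (b + 1))`. -/
def solitaryWave (b c k : ℝ) : ℝ → ℝ := Classical.epsilon (IsSolitaryWave b c k)

/-- The integrand of the functional `Q`. -/
def densityQ (b c k : ℝ) (φ : ℝ → ℝ) (x : ℝ) : ℝ :=
  b * ((c - k) / (c - φ x)) - ((c - k) / (c - φ x)) ^ b - b + 1

/-- The map `k ↦ Q(φ)`, where `φ` is the solitary wave profile on the background `k`. -/
def mapQ (b c k : ℝ) : ℝ := ∫ x, densityQ b c k (solitaryWave b c k) x

/-- The normalized parameter `γ` as a function of `k`. -/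
def gammaOf (b c k : ℝ) : ℝ := (c - k * (b + 1)) / (c - k)

/-- The background `k` as a function of the normalized parameter `γ`, i.e. the inverse of `gammaOf`. -/
def kOf (b c γ : ℝ) : ℝ := c * (1 - γ) / (b + 1 - γ)

theorem kOf_gammaOf {b c k : ℝ} (hb : 1 < b) (hc : 0 < c) (hk : k ∈ Ioo 0 (c / (b + 1))) :
    gammaOf b c k ∈ Ioo (0 : ℝ) 1 ∧ kOf b c (gammaOf b c k) = k := by
  obtain ⟨h0, h1⟩ := hk
  rw [lt_div_iff₀ (by linarith)] at h1
  have h2 : 0 < c - k := by nlinarith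
  have h3 : b + 1 - (c - k * (b + 1)) / (c - k) = b * c / (c - k) := by
    field_simp
    ring
  refine ⟨⟨div_pos (by linarith) h2, ?_⟩, ?_⟩
  · rw [gammaOf, div_lt_one h2]
    nlinarith
  · rw [kOf, gammaOf, h3]
    have : b ≠ 0 := by linarith
    field_simp
    ring

theorem gammaOf_kOf {b c γ : ℝ} (hb : 1 < b) (hc : 0 < c) (hγ : γ ∈ Ioo (0 : ℝ) 1) :
    kOf b c γ ∈ Ioo 0 (c / (b + 1)) ∧ gammaOf b c (kOf b c γ) = γ := by
  obtain ⟨h0, h1⟩ := hγ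
  have h2 : 0 < b + 1 - γ := by linarith
  have h3 : c - c * (1 - γ) / (b + 1 - γ) = b * c / (b + 1 - γ) := by
    field_simp
    ring
  refine ⟨⟨div_pos (mul_pos hc (by linarith)) h2, ?_⟩, ?_⟩
  · rw [kOf, div_lt_div_iff₀ h2 (by linarith)]
    nlinarith [mul_pos (mul_pos hc h0) (by linarith : 0 < b)]
  · rw [gammaOf, kOf, h3]
    have : b ≠ 0 := by linarith
    field_simp
    ring

end

/-!
In the variable `z = (φ - k) / (c - k)` the momentum conservation law turns the equation into
`z'' = z - κ * h'(z)` with `κ = k / (c - k)` and `h = pot b`, and the energy of a decaying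
solution gives `z' ^ 2 = z ^ 2 * (1 - κ * H z)`, where `H z = 2 * h z / z ^ 2` increases from `b`
to `∞` on `[0, 1)`. Hence the wave is the homoclinic orbit at the level `κ⁻¹ = b + Y`.
Its two halves are uniformized by `σ ∈ (-1, 1)` with `H z = b + Y * (1 - σ ^ 2)`, which gives
`Q = -2 * √(Y * (b + Y)) * ∫ σ in (-1, 1), W (z σ)` for a weight `W` independent of `Y`. The domain
of integration is now fixed and the integrand regular, so `Q` can be differentiated in
`Y = b * γ / (1 - γ)`. For small `Y` the sign comes from `W 0 = 0 < W' 0`. For large `Y` the orbit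
concentrates at `z = 1`, where `W → 1 / 2` while the derivative of `W` with respect to
`log (H - b)` tends to zero, so the factor `√(Y * (b + Y))` dominates.
-/

noncomputable section

/-! ### Calculus on the line -/

/-- The function `f z / z ^ 2`, continued to `z = 0` when `f` vanishes to second order there. -/
def sqQuot (f : ℝ → ℝ) : ℝ → ℝ := dslope (dslope f 0) 0

section SqQuot

variable {f f' f'' f''' : ℝ → ℝ} {s : Set ℝ} {m z : ℝ}

theorem sqQuot_of_ne (hf : f 0 = 0) (hf' : HasDerivAt f 0 0) (hz : z ≠ 0) :
    sqQuot f z = f z / z ^ 2 := by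
  rw [sqQuot, dslope_of_ne _ hz, slope_def_field, dslope_same, hf'.deriv, dslope_of_ne _ hz,
    slope_def_field, hf]
  field_simp
  ring

theorem sq_mul_sqQuot (hf : f 0 = 0) (hf' : HasDerivAt f 0 0) (z : ℝ) :
    z ^ 2 * sqQuot f z = f z := by
  rcases eq_or_ne z 0 with rfl | hz
  · simp [hf]
  · rw [sqQuot_of_ne hf hf' hz]
    field_simp

theorem analyticAt_dslope {a : ℝ} (ha : AnalyticAt ℝ f a) (hz : AnalyticAt ℝ f z) :
    AnalyticAt ℝ (dslope f a) z := by
  rcases eq_or_ne z a with rfl | hne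
  · obtain ⟨p, hp⟩ := ha
    exact ⟨_, hp.has_fpower_series_dslope_fslope⟩
  · have hslope : AnalyticAt ℝ (fun x => (f x - f a) / (x - a)) z :=
      (hz.sub analyticAt_const).fun_div (analyticAt_id.sub analyticAt_const) (sub_ne_zero.2 hne)
    refine hslope.congr ?_
    filter_upwards [isOpen_ne.mem_nhds hne] with x hx
    rw [dslope_of_ne f hx, slope_def_field]

theorem analyticAt_sqQuot (h0 : AnalyticAt ℝ f 0) (hz : AnalyticAt ℝ f z) :
    AnalyticAt ℝ (sqQuot f) z :=
  analyticAt_dslope (analyticAt_dslope h0 h0) (analyticAt_dslope h0 hz)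

theorem hasDerivAt_sqQuot (h0 : AnalyticAt ℝ f 0) (hz : AnalyticAt ℝ f z) :
    HasDerivAt (sqQuot f) (deriv (sqQuot f) z) z :=
  (analyticAt_sqQuot h0 hz).differentiableAt.hasDerivAt

theorem deriv_eq_sqQuot (hf : f 0 = 0) (hf' : HasDerivAt f 0 0) (h0 : AnalyticAt ℝ f 0)
    (hz : AnalyticAt ℝ f z) :
    deriv f z = 2 * z * sqQuot f z + z ^ 2 * deriv (sqQuot f) z := by
  have hprod := (hasDerivAt_pow 2 z).mul (hasDerivAt_sqQuot h0 hz)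
  have hfun : (fun z => z ^ 2) * sqQuot f = f := funext (sq_mul_sqQuot hf hf')
  rw [hfun] at hprod
  simpa using hprod.deriv

theorem sqQuot_zero (hf : f 0 = 0) (hf' : HasDerivAt f 0 0) (h0 : AnalyticAt ℝ f 0) :
    sqQuot f 0 = deriv (deriv f) 0 / 2 := by
  have hderiv : deriv f =ᶠ[𝓝 0] fun z => 2 * z * sqQuot f z + z ^ 2 * deriv (sqQuot f) z :=
    h0.eventually_analyticAt.mono fun z hz => deriv_eq_sqQuot hf hf' h0 hz
  have hlin := ((hasDerivAt_id (0 : ℝ)).const_mul 2).mul (hasDerivAt_sqQuot h0 h0)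
  have hsq := (hasDerivAt_pow 2 (0 : ℝ)).mul
    (analyticAt_sqQuot h0 h0).deriv.differentiableAt.hasDerivAt
  have hval := (hlin.add hsq).congr_of_eventuallyEq hderiv
  rw [hval.deriv]
  simp

theorem half_mul_sq_le (hs : Convex ℝ s) (hmem : (0 : ℝ) ∈ s)
    (hf : ∀ x ∈ s, HasDerivAt f (f' x) x) (hf' : ∀ x ∈ s, HasDerivAt f' (f'' x) x)
    (hf0 : f 0 = 0) (hf'0 : f' 0 = 0) (hm : ∀ x ∈ s, m ≤ f'' x) (hz : z ∈ s) :
    m / 2 * z ^ 2 ≤ f z := by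
  have hg : ∀ x ∈ s, HasDerivAt (fun x => f x - m / 2 * x ^ 2) (f' x - m * x) x := fun x hx => by
    convert! (hf x hx).sub ((hasDerivAt_pow 2 x).const_mul (m / 2)) using 1
    simp
    ring
  have hg' : ∀ x ∈ s, HasDerivAt (fun x => f' x - m * x) (f'' x - m) x := fun x hx => by
    convert! (hf' x hx).sub ((hasDerivAt_id x).const_mul m) using 1
    simp
  have hconv : ConvexOn ℝ s fun x => f x - m / 2 * x ^ 2 :=
    convexOn_of_hasDerivWithinAt2_nonneg hs (fun x hx => (hg x hx).continuousAt.continuousWithinAt)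
      (fun x hx => (hg x (interior_subset hx)).hasDerivWithinAt)
      (fun x hx => (hg' x (interior_subset hx)).hasDerivWithinAt)
      fun x hx => sub_nonneg.2 (hm x (interior_subset hx))
  have hcrit : HasDerivAt (fun x => f x - m / 2 * x ^ 2) 0 0 := by simpa [hf'0] using hg 0 hmem
  suffices 0 ≤ f z - m / 2 * z ^ 2 by linarith
  rcases lt_trichotomy z 0 with hneg | rfl | hpos
  · have := hconv.slope_le_of_hasDerivAt hz hmem hneg hcrit
    rw [slope_def_field, div_le_iff₀ (by linarith)] at this
    simpa [hf0] using this
  · simp [hf0]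
  · have := hconv.le_slope_of_hasDerivAt hmem hz hpos hcrit
    rw [slope_def_field, le_div_iff₀ (by linarith)] at this
    simpa [hf0] using this

theorem sixth_mul_cube_le (hs : Convex ℝ s) (hmem : (0 : ℝ) ∈ s) (hnonneg : s ⊆ Ici 0)
    (hf : ∀ x ∈ s, HasDerivAt f (f' x) x) (hf' : ∀ x ∈ s, HasDerivAt f' (f'' x) x)
    (hf'' : ∀ x ∈ s, HasDerivAt f'' (f''' x) x) (hf0 : f 0 = 0) (hf'0 : f' 0 = 0)
    (hm : ∀ x ∈ s, m ≤ f''' x) (hz : z ∈ s) :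
    m / 6 * z ^ 3 ≤ z * f' z - 2 * f z := by
  have hg : ∀ x ∈ s, HasDerivAt (fun x => x * f' x - 2 * f x - m / 6 * x ^ 3)
      (x * f'' x - f' x - m / 2 * x ^ 2) x := fun x hx => by
    convert! (((hasDerivAt_id x).mul (hf' x hx)).sub ((hf x hx).const_mul 2)).sub
      ((hasDerivAt_pow 3 x).const_mul (m / 6)) using 1
    simp
    ring
  have hg' : ∀ x ∈ s, HasDerivAt (fun x => x * f'' x - f' x - m / 2 * x ^ 2)
      (x * (f''' x - m)) x := fun x hx => by
    convert! (((hasDerivAt_id x).mul (hf'' x hx)).sub (hf' x hx)).sub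
      ((hasDerivAt_pow 2 x).const_mul (m / 2)) using 1
    simp
    ring
  have := half_mul_sq_le hs hmem hg hg' (by simp [hf0]) (by simp [hf'0])
    (fun x hx => mul_nonneg (hnonneg hx) (sub_nonneg.2 (hm x hx))) hz
  linarith

theorem le_of_forall_Ioo_le {g : ℝ → ℝ} {a b : ℝ} (hab : a < b) (hg : ContinuousAt g a)
    (h : ∀ x ∈ Ioo a b, m ≤ g x) : m ≤ g a :=
  ge_of_tendsto (hg.tendsto.mono_left (nhdsWithin_le_nhds (s := Ioi a)))
    (mem_of_superset (Ioo_mem_nhdsGT hab) h)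

variable {a : ℝ}

theorem le_sqQuot (han : ∀ x ∈ Ico 0 a, AnalyticAt ℝ f x)
    (hf : ∀ x ∈ Ico 0 a, HasDerivAt f (f' x) x) (hf' : ∀ x ∈ Ico 0 a, HasDerivAt f' (f'' x) x)
    (hf0 : f 0 = 0) (hf'0 : f' 0 = 0) (hm : ∀ x ∈ Ico 0 a, m ≤ f'' x) (hz : z ∈ Ico 0 a) :
    m / 2 ≤ sqQuot f z := by
  have hmem : (0 : ℝ) ∈ Ico 0 a := ⟨le_rfl, hz.1.trans_lt hz.2⟩
  have hd0 : HasDerivAt f 0 0 := by simpa only [hf'0] using hf 0 hmem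
  have hpos : ∀ x ∈ Ioo 0 a, m / 2 ≤ sqQuot f x := fun x hx => by
    have := half_mul_sq_le (convex_Ico 0 a) hmem hf hf' hf0 hf'0 hm (Ioo_subset_Ico_self hx)
    rw [← sq_mul_sqQuot hf0 hd0, mul_comm] at this
    exact le_of_mul_le_mul_left this (pow_pos hx.1 2)
  rcases hz.1.eq_or_lt with rfl | hz0
  · exact le_of_forall_Ioo_le hz.2 (analyticAt_sqQuot (han 0 hmem) (han 0 hmem)).continuousAt hpos
  · exact hpos z ⟨hz0, hz.2⟩

theorem le_deriv_sqQuot (han : ∀ x ∈ Ico 0 a, AnalyticAt ℝ f x)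
    (hf : ∀ x ∈ Ico 0 a, HasDerivAt f (f' x) x) (hf' : ∀ x ∈ Ico 0 a, HasDerivAt f' (f'' x) x)
    (hf'' : ∀ x ∈ Ico 0 a, HasDerivAt f'' (f''' x) x) (hf0 : f 0 = 0) (hf'0 : f' 0 = 0)
    (hm : ∀ x ∈ Ico 0 a, m ≤ f''' x) (hz : z ∈ Ico 0 a) :
    m / 6 ≤ deriv (sqQuot f) z := by
  have hmem : (0 : ℝ) ∈ Ico 0 a := ⟨le_rfl, hz.1.trans_lt hz.2⟩
  have hd0 : HasDerivAt f 0 0 := by simpa only [hf'0] using hf 0 hmem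
  have hpos : ∀ x ∈ Ioo 0 a, m / 6 ≤ deriv (sqQuot f) x := fun x hx => by
    have hx' := Ioo_subset_Ico_self hx
    have hlower := sixth_mul_cube_le (convex_Ico 0 a) hmem (fun _ => And.left) hf hf' hf'' hf0 hf'0
      hm hx'
    rw [← (hf x hx').deriv, deriv_eq_sqQuot hf0 hd0 (han 0 hmem) (han x hx'),
      ← sq_mul_sqQuot hf0 hd0] at hlower
    refine le_of_mul_le_mul_left ?_ (pow_pos hx.1 3)
    linarith
  rcases hz.1.eq_or_lt with rfl | hz0
  · exact le_of_forall_Ioo_le hz.2 (analyticAt_sqQuot (han 0 hmem) (han 0 hmem)).deriv.continuousAt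
      hpos
  · exact hpos z ⟨hz0, hz.2⟩

end SqQuot

section InvFunOn

open Function

variable {f f' : ℝ → ℝ} {s t : Set ℝ} {a b y : ℝ} {l : Filter ℝ}

theorem strictMonoOn_invFunOn (hf : StrictMonoOn f s) (ht : t ⊆ f '' s) :
    StrictMonoOn (invFunOn f s) t := by
  intro x hx y hy hxy
  obtain ⟨hxs, hxf⟩ := invFunOn_pos (ht hx)
  obtain ⟨hys, hyf⟩ := invFunOn_pos (ht hy)
  rw [← hxf, ← hyf] at hxy
  exact (hf.lt_iff_lt hxs hys).1 hxy

theorem hasDerivAt_invFunOn (hs : IsOpen s) (hmono : StrictMonoOn f s)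
    (hf : ∀ x ∈ s, HasDerivAt f (f' x) x) (hpos : ∀ x ∈ s, 0 < f' x) (hy : f '' s ∈ 𝓝 y) :
    HasDerivAt (invFunOn f s) (f' (invFunOn f s y))⁻¹ y := by
  have hmem : invFunOn f s y ∈ s := invFunOn_mem (show y ∈ f '' s from mem_of_mem_nhds hy)
  have himage : invFunOn f s '' (f '' s) ∈ 𝓝 (invFunOn f s y) :=
    mem_of_superset (hs.mem_nhds hmem) fun x hx =>
      ⟨f x, mem_image_of_mem f hx, hmono.injOn.leftInvOn_invFunOn hx⟩
  exact HasDerivAt.of_local_left_inverse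
    ((strictMonoOn_invFunOn hmono subset_rfl).continuousAt_of_image_mem_nhds hy himage)
    (hf _ hmem) (hpos _ hmem).ne' (mem_of_superset hy fun _ => invFunOn_eq)

theorem tendsto_invFunOn_nhdsLT (hab : a < b) (hmono : StrictMonoOn f (Ioo a b))
    (himage : f '' Ioo a b ∈ l) (hlt : ∀ x ∈ Ioo a b, ∀ᶠ y in l, f x < y) :
    Tendsto (invFunOn f (Ioo a b)) l (𝓝[<] b) := by
  refine (nhdsLT_basis b).tendsto_right_iff.2 fun c hc => ?_
  obtain ⟨x, hx, hxb⟩ := exists_between (max_lt hab hc)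
  have hxmem : x ∈ Ioo a b := ⟨(le_max_left _ _).trans_lt hx, hxb⟩
  filter_upwards [himage, hlt x hxmem] with y hy hxy
  obtain ⟨hmem, hval⟩ := invFunOn_pos hy
  rw [← hval, hmono.lt_iff_lt hxmem hmem] at hxy
  exact ⟨(le_max_right _ _).trans_lt (hx.trans hxy), hmem.2⟩

theorem tendsto_invFunOn_nhdsGT (hab : a < b) (hmono : StrictMonoOn f (Ioo a b))
    (himage : f '' Ioo a b ∈ l) (hlt : ∀ x ∈ Ioo a b, ∀ᶠ y in l, y < f x) :
    Tendsto (invFunOn f (Ioo a b)) l (𝓝[>] a) := by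
  refine (nhdsGT_basis a).tendsto_right_iff.2 fun c hc => ?_
  obtain ⟨x, hax, hx⟩ := exists_between (lt_min hab hc)
  have hxmem : x ∈ Ioo a b := ⟨hax, hx.trans_le (min_le_left _ _)⟩
  filter_upwards [himage, hlt x hxmem] with y hy hxy
  obtain ⟨hmem, hval⟩ := invFunOn_pos hy
  rw [← hval, hmono.lt_iff_lt hmem hxmem] at hxy
  exact ⟨hmem.1, hxy.trans (hx.trans_le (min_le_right _ _))⟩

end InvFunOn

section Autonomous

variable {E : Type*} [NormedAddCommGroup E] [NormedSpace ℝ E] {v : E → E} {u u₁ u₂ : ℝ → E}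

theorem eq_of_hasDerivAt_autonomous (hv : ∀ t, ContDiffAt ℝ 1 v (u₁ t))
    (hu₁ : ∀ t, HasDerivAt u₁ (v (u₁ t)) t) (hu₂ : ∀ t, HasDerivAt u₂ (v (u₂ t)) t) {t₀ : ℝ}
    (heq : u₁ t₀ = u₂ t₀) : u₁ = u₂ := by
  have hcont₁ : Continuous u₁ := continuous_iff_continuousAt.2 fun t => (hu₁ t).continuousAt
  have hcont₂ : Continuous u₂ := continuous_iff_continuousAt.2 fun t => (hu₂ t).continuousAt
  have hopen : IsOpen {t | u₁ t = u₂ t} := isOpen_iff_mem_nhds.2 fun t ht => by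
    obtain ⟨K, s, hs, hlip⟩ := (hv t).exists_lipschitzOnWith
    refine ODE_solution_unique_of_eventually (v := fun _ => v) (s := fun _ => s) (K := K)
      (Eventually.of_forall fun _ => hlip) ?_ ?_ ht
    · filter_upwards [hcont₁.continuousAt.eventually_mem hs] with x hx using ⟨hu₁ x, hx⟩
    · filter_upwards [hcont₂.continuousAt.eventually_mem ((show u₁ t = u₂ t from ht) ▸ hs)]
        with x hx using ⟨hu₂ x, hx⟩
  have huniv := IsClopen.eq_univ ⟨isClosed_eq hcont₁ hcont₂, hopen⟩ ⟨t₀, heq⟩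
  exact funext fun t => huniv.ge (mem_univ t)

theorem contDiff_of_hasDerivAt_autonomous (hv : ∀ t, ContDiffAt ℝ ∞ v (u t))
    (hu : ∀ t, HasDerivAt u (v (u t)) t) : ContDiff ℝ ∞ u := by
  refine contDiff_infty.2 fun n => ?_
  induction n with
  | zero =>
    exact contDiff_zero.2 (continuous_iff_continuousAt.2 fun t => (hu t).continuousAt)
  | succ n ih =>
    rw [Nat.cast_succ]
    refine contDiff_succ_iff_deriv.2 ⟨fun t => (hu t).differentiableAt, by simp, ?_⟩
    rw [show deriv u = v ∘ u from funext fun t => (hu t).deriv]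
    exact contDiff_iff_contDiffAt.2 fun t =>
      ((hv t).of_le (mod_cast le_top)).comp t ih.contDiffAt

variable {g : ℝ → ℝ} {z w z₁ w₁ z₂ w₂ : ℝ → ℝ}

theorem eq_of_hasDerivAt_second_order (hg : ∀ t, ContDiffAt ℝ 1 g (z₁ t))
    (hz₁ : ∀ t, HasDerivAt z₁ (w₁ t) t) (hw₁ : ∀ t, HasDerivAt w₁ (g (z₁ t)) t)
    (hz₂ : ∀ t, HasDerivAt z₂ (w₂ t) t) (hw₂ : ∀ t, HasDerivAt w₂ (g (z₂ t)) t) {t₀ : ℝ}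
    (hz : z₁ t₀ = z₂ t₀) (hw : w₁ t₀ = w₂ t₀) : z₁ = z₂ := by
  have hpair := eq_of_hasDerivAt_autonomous (v := fun q : ℝ × ℝ => (q.2, g q.1))
    (u₁ := fun t => (z₁ t, w₁ t)) (u₂ := fun t => (z₂ t, w₂ t))
    (fun t => contDiffAt_snd.prodMk (.fst'' (hg t)))
    (fun t => (hz₁ t).prodMk (hw₁ t)) (fun t => (hz₂ t).prodMk (hw₂ t)) (Prod.ext hz hw)
  exact funext fun t => congrArg Prod.fst (congrFun hpair t)

theorem contDiff_of_hasDerivAt_second_order (hg : ∀ t, ContDiffAt ℝ ∞ g (z t))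
    (hz : ∀ t, HasDerivAt z (w t) t) (hw : ∀ t, HasDerivAt w (g (z t)) t) : ContDiff ℝ ∞ z :=
  (contDiff_of_hasDerivAt_autonomous (v := fun q : ℝ × ℝ => (q.2, g q.1))
    (u := fun t => (z t, w t)) (fun t => contDiffAt_snd.prodMk (.fst'' (hg t)))
    fun t => (hz t).prodMk (hw t)).fst

end Autonomous

section LimitAtInfinity

variable {u u' u'' z w g V : ℝ → ℝ} {l L : ℝ}

theorem exists_ge_deriv_eq_sub (hu : ∀ x, HasDerivAt u (u' x) x) (x : ℝ) :
    ∃ ξ, x ≤ ξ ∧ u' ξ = u (x + 1) - u x := by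
  obtain ⟨ξ, hξ, hslope⟩ := exists_hasDerivAt_eq_slope u u' (lt_add_one x)
    (HasDerivAt.continuousOn fun x _ => hu x) fun x _ => hu x
  exact ⟨ξ, hξ.1.le, by simpa using hslope⟩

theorem tendsto_forward_difference (hl : Tendsto u atTop (𝓝 l)) :
    Tendsto (fun x => u (x + 1) - u x) atTop (𝓝 0) := by
  simpa using (hl.comp (tendsto_atTop_add_const_right atTop (1 : ℝ) tendsto_id)).sub hl

theorem exists_tendsto_deriv_zero (hu : ∀ x, HasDerivAt u (u' x) x)
    (hl : Tendsto u atTop (𝓝 l)) :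
    ∃ ξ : ℝ → ℝ, Tendsto ξ atTop atTop ∧ Tendsto (fun x => u' (ξ x)) atTop (𝓝 0) := by
  choose ξ hξ hval using exists_ge_deriv_eq_sub hu
  refine ⟨ξ, tendsto_atTop_mono hξ tendsto_id, ?_⟩
  simp only [hval]
  exact tendsto_forward_difference hl

theorem second_deriv_limit_eq_zero (hu : ∀ x, HasDerivAt u (u' x) x)
    (hu' : ∀ x, HasDerivAt u' (u'' x) x) (hl : Tendsto u atTop (𝓝 l))
    (hL : Tendsto u'' atTop (𝓝 L)) : L = 0 := by
  choose η hη hval using exists_ge_deriv_eq_sub hu'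
  have hdiff : Tendsto (fun x => u' (x + 1) - u' x) atTop (𝓝 L) := by
    simp only [← hval]
    exact hL.comp (tendsto_atTop_mono hη tendsto_id)
  obtain ⟨ξ, hξ, hzero⟩ := exists_tendsto_deriv_zero
    (fun x => ((hu (x + 1)).comp_add_const x 1).sub (hu x)) (tendsto_forward_difference hl)
  exact tendsto_nhds_unique (hdiff.comp hξ) hzero

theorem sq_deriv_eq_of_tendsto (hz : ∀ x, HasDerivAt z (w x) x)
    (hw : ∀ x, HasDerivAt w (g (z x)) x) (hV : ∀ x, HasDerivAt V (g (z x)) (z x))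
    (hVl : ContinuousAt V l) (hl : Tendsto z atTop (𝓝 l)) (x : ℝ) :
    w x ^ 2 = 2 * (V (z x) - V l) := by
  have henergy : ∀ t, HasDerivAt (fun t => w t ^ 2 - 2 * V (z t)) 0 t := fun t => by
    convert! ((hw t).pow 2).sub (((hV t).comp t (hz t)).const_mul 2) using 1
    ring
  have hconst : ∀ t, w t ^ 2 - 2 * V (z t) = w x ^ 2 - 2 * V (z x) := fun t =>
    is_const_of_deriv_eq_zero (fun t => (henergy t).differentiableAt) (fun t => (henergy t).deriv)
      t x
  obtain ⟨ξ, hξ, hzero⟩ := exists_tendsto_deriv_zero hz hl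
  have hlim : Tendsto (fun t => w (ξ t) ^ 2 - 2 * V (z (ξ t))) atTop (𝓝 (0 ^ 2 - 2 * V l)) :=
    (hzero.pow 2).sub ((hVl.tendsto.comp (hl.comp hξ)).const_mul 2)
  simp only [hconst] at hlim
  linarith [tendsto_nhds_unique hlim tendsto_const_nhds]

end LimitAtInfinity

section OneSubRpow

variable {r z : ℝ}

theorem hasDerivAt_one_sub_rpow (r : ℝ) (hz : z < 1) :
    HasDerivAt (fun z : ℝ => (1 - z) ^ r) (-(r * (1 - z) ^ (r - 1))) z := by
  convert! ((hasDerivAt_id z).const_sub 1).rpow_const (p := r) (Or.inl (sub_pos.2 hz).ne') using 1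
  simp

theorem analyticAt_one_sub_rpow (r : ℝ) (hz : z < 1) :
    AnalyticAt ℝ (fun z : ℝ => (1 - z) ^ r) z :=
  ((contDiffAt_const.sub contDiffAt_id).rpow_const_of_ne (sub_pos.2 hz).ne').analyticAt

theorem one_le_one_sub_rpow (hr : r ≤ 0) (hz : z ∈ Ico (0 : ℝ) 1) : 1 ≤ (1 - z) ^ r :=
  Real.one_le_rpow_of_pos_of_le_one_of_nonpos (by linarith [hz.2]) (by linarith [hz.1]) hr

theorem tendsto_one_sub_nhdsLT : Tendsto (fun z : ℝ => 1 - z) (𝓝[<] 1) (𝓝[>] 0) := by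
  have hcont : Tendsto (fun z : ℝ => 1 - z) (𝓝 1) (𝓝 0) := by
    simpa using (tendsto_id (x := 𝓝 (1 : ℝ))).const_sub 1
  exact tendsto_nhdsWithin_iff.2 ⟨hcont.mono_left nhdsWithin_le_nhds,
    eventually_mem_nhdsWithin.mono fun _ hz => mem_Ioi.2 (sub_pos.2 hz)⟩

theorem tendsto_prodMk_one_sub_rpow (hr : 0 < r) :
    Tendsto (fun z : ℝ => (z, (1 - z) ^ r)) (𝓝[<] 1) (𝓝 (1, 0)) := by
  have hcont : ContinuousAt (fun z : ℝ => (z, (1 - z) ^ r)) 1 :=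
    continuousAt_id.prodMk ((continuousAt_const.sub continuousAt_id).rpow_const (Or.inr hr.le))
  simpa [ContinuousAt, Real.zero_rpow hr.ne'] using
    hcont.tendsto.mono_left (nhdsWithin_le_nhds (s := Iio 1))

theorem tendsto_one_sub_mul_deriv_comp {G : ℝ × ℝ → ℝ} (hr : 0 < r)
    (hG : ContDiffAt ℝ 1 G (1, 0)) :
    Tendsto (fun z => (1 - z) * deriv (fun x => G (x, (1 - x) ^ r)) z) (𝓝[<] 1) (𝓝 0) := by
  have hcurve := tendsto_prodMk_one_sub_rpow hr
  have hdir : Tendsto (fun z : ℝ => (1 - z, -(r * (1 - z) ^ r))) (𝓝[<] 1) (𝓝 (0, 0)) := by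
    have hsnd := ((continuous_snd.tendsto _).comp hcurve).const_mul r
    exact (tendsto_one_sub_nhdsLT.mono_right nhdsWithin_le_nhds).prodMk_nhds
      (by simpa using hsnd.neg)
  have hfderiv : Tendsto (fun z => fderiv ℝ G (z, (1 - z) ^ r) (1 - z, -(r * (1 - z) ^ r)))
      (𝓝[<] 1) (𝓝 (fderiv ℝ G (1, 0) (0, 0))) :=
    (isBoundedBilinearMap_apply.continuous.tendsto _).comp
      (((hG.continuousAt_fderiv one_ne_zero).tendsto.comp hcurve).prodMk_nhds hdir)
  rw [Prod.mk_zero_zero, map_zero] at hfderiv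
  refine hfderiv.congr' ?_
  filter_upwards [hcurve.eventually (hG.eventually (by simp)), self_mem_nhdsWithin]
    with z hdiff hz
  have hpos : 0 < 1 - z := sub_pos.2 hz
  have hchain : HasDerivAt (fun x => G (x, (1 - x) ^ r))
      (fderiv ℝ G (z, (1 - z) ^ r) (1, -(r * (1 - z) ^ (r - 1)))) z :=
    (hdiff.differentiableAt one_ne_zero).hasFDerivAt.comp_hasDerivAt z
      ((hasDerivAt_id z).prodMk (hasDerivAt_one_sub_rpow r hz))
  rw [hchain.deriv, ← smul_eq_mul (1 - z), ← map_smul]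
  congr 1
  simp only [Prod.smul_mk, smul_eq_mul, mul_one, Real.rpow_sub_one hpos.ne']
  congr 1
  field_simp

end OneSubRpow

/-! ### Homoclinic orbits in a uniformizing parameter -/

/-- A function `H` on `[0, 1)` for which the level `H 0 + Y` of the equation
`z' ^ 2 = z ^ 2 * (1 - H z / (H 0 + Y))` carries an orbit homoclinic to `z = 0`, for every
`Y > 0`. -/
structure IsHomoclinicRatio (H : ℝ → ℝ) : Prop where
  contDiffAt : ∀ z ∈ Ico (0 : ℝ) 1, ContDiffAt ℝ 1 H z
  deriv_pos : ∀ z ∈ Ico (0 : ℝ) 1, 0 < deriv H z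
  zero_pos : 0 < H 0
  tendsto_atTop : Tendsto H (𝓝[<] 1) atTop

/-- The point `z` of `(0, 1)` with `H z = H 0 + y`, meaningful for `y > 0`. -/
def ratioInv (H : ℝ → ℝ) (y : ℝ) : ℝ := Function.invFunOn H (Ioo 0 1) (H 0 + y)

/-- The height of the homoclinic orbit at the level `H 0 + Y`, in the uniformizing parameter
`σ ∈ (-1, 1)` for which `√(1 - H z / (H 0 + Y))` is a multiple of `|σ|`. -/
def orbit (H : ℝ → ℝ) (Y σ : ℝ) : ℝ := ratioInv H (Y * (1 - σ ^ 2))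

/-- The derivative `dx / dσ` of the position on the homoclinic orbit. -/
def slowness (H : ℝ → ℝ) (Y σ : ℝ) : ℝ :=
  2 * √(Y * (H 0 + Y)) / (orbit H Y σ * deriv H (orbit H Y σ))

/-- The position `x` on the homoclinic orbit, as a function of the uniformizing parameter. -/
def position (H : ℝ → ℝ) (Y σ : ℝ) : ℝ := ∫ s in (0 : ℝ)..σ, slowness H Y s

/-- The uniformizing parameter of the homoclinic orbit, as a function of the position. -/
def parameter (H : ℝ → ℝ) (Y x : ℝ) : ℝ := Function.invFunOn (position H Y) (Ioo (-1) 1) x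

/-- The height of the homoclinic orbit, as a function of the position. -/
def profile (H : ℝ → ℝ) (Y x : ℝ) : ℝ := orbit H Y (parameter H Y x)

/-- The derivative of `W` with respect to `log (H z - H 0)`. -/
def logSlope (H W : ℝ → ℝ) (z : ℝ) : ℝ := (H z - H 0) * (deriv W z / deriv H z)

/-- The integral over the line of `z * deriv H z * W z` along the profile `z` at the level
`H 0 + Y`, computed in the uniformizing parameter. -/
def profileIntegral (H W : ℝ → ℝ) (Y : ℝ) : ℝ :=
  2 * √(Y * (H 0 + Y)) * ∫ σ in Ioo (-1) 1, W (orbit H Y σ)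

theorem continuousOn_deriv_of_contDiffAt {f : ℝ → ℝ} {s : Set ℝ}
    (hf : ∀ z ∈ s, ContDiffAt ℝ 1 f z) : ContinuousOn (deriv f) s := fun z hz =>
  (((hf z hz).continuousAt_fderiv one_ne_zero).clm_apply continuousAt_const).continuousWithinAt

theorem one_sub_sq_pos {σ : ℝ} (hσ : σ ∈ Ioo (-1 : ℝ) 1) : 0 < 1 - σ ^ 2 := by
  nlinarith [hσ.1, hσ.2]

section Homoclinic

variable {H W : ℝ → ℝ} {y z Y σ : ℝ}

theorem orbit_neg (H : ℝ → ℝ) (Y σ : ℝ) : orbit H Y (-σ) = orbit H Y σ := by simp [orbit]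

theorem slowness_neg (H : ℝ → ℝ) (Y σ : ℝ) : slowness H Y (-σ) = slowness H Y σ := by
  simp [slowness, orbit_neg]

theorem position_zero (H : ℝ → ℝ) (Y : ℝ) : position H Y 0 = 0 := by simp [position]

theorem position_neg (H : ℝ → ℝ) (Y σ : ℝ) : position H Y (-σ) = -position H Y σ := by
  have hreflect := intervalIntegral.integral_comp_neg (a := 0) (b := σ) (slowness H Y)
  simp only [slowness_neg, neg_zero] at hreflect
  rw [position, position, hreflect, intervalIntegral.integral_symm]

namespace IsHomoclinicRatio

theorem hasDerivAt (hH : IsHomoclinicRatio H) (hz : z ∈ Ico (0 : ℝ) 1) :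
    HasDerivAt H (deriv H z) z :=
  ((hH.contDiffAt z hz).differentiableAt one_ne_zero).hasDerivAt

theorem continuousOn_deriv (hH : IsHomoclinicRatio H) : ContinuousOn (deriv H) (Ico 0 1) :=
  continuousOn_deriv_of_contDiffAt hH.contDiffAt

theorem continuousOn (hH : IsHomoclinicRatio H) : ContinuousOn H (Ico 0 1) :=
  HasDerivAt.continuousOn fun _ => hH.hasDerivAt

theorem strictMonoOn (hH : IsHomoclinicRatio H) : StrictMonoOn H (Ico 0 1) :=
  strictMonoOn_of_deriv_pos (convex_Ico 0 1) hH.continuousOn fun z hz =>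
    hH.deriv_pos z (interior_subset hz)

theorem strictMonoOn_Ioo (hH : IsHomoclinicRatio H) : StrictMonoOn H (Ioo 0 1) :=
  hH.strictMonoOn.mono Ioo_subset_Ico_self

theorem zero_lt (hH : IsHomoclinicRatio H) (hz : z ∈ Ioo (0 : ℝ) 1) : H 0 < H z :=
  hH.strictMonoOn ⟨le_rfl, one_pos⟩ (Ioo_subset_Ico_self hz) hz.1

theorem Ioi_subset_image (hH : IsHomoclinicRatio H) : Ioi (H 0) ⊆ H '' Ioo 0 1 :=
  isPreconnected_Ioo.intermediate_value_Ioi (le_principal_iff.2 (Ioo_mem_nhdsGT one_pos))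
    (le_principal_iff.2 (Ioo_mem_nhdsLT one_pos)) (hH.continuousOn.mono Ioo_subset_Ico_self)
    ((hH.hasDerivAt ⟨le_rfl, one_pos⟩).continuousAt.tendsto.mono_left nhdsWithin_le_nhds)
    hH.tendsto_atTop

theorem add_mem_image (hH : IsHomoclinicRatio H) (hy : 0 < y) : H 0 + y ∈ H '' Ioo 0 1 :=
  hH.Ioi_subset_image (by simpa using hy)

theorem ratioInv_mem (hH : IsHomoclinicRatio H) (hy : 0 < y) : ratioInv H y ∈ Ioo (0 : ℝ) 1 :=
  Function.invFunOn_mem (hH.add_mem_image hy)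

theorem apply_ratioInv (hH : IsHomoclinicRatio H) (hy : 0 < y) : H (ratioInv H y) = H 0 + y :=
  Function.invFunOn_eq (hH.add_mem_image hy)

theorem strictMonoOn_ratioInv (hH : IsHomoclinicRatio H) : StrictMonoOn (ratioInv H) (Ioi 0) :=
  fun _ hx _ hy hxy => strictMonoOn_invFunOn hH.strictMonoOn_Ioo hH.Ioi_subset_image
    (by simpa using hx) (by simpa using hy) (by linarith)

theorem hasDerivAt_ratioInv (hH : IsHomoclinicRatio H) (hy : 0 < y) :
    HasDerivAt (ratioInv H) (deriv H (ratioInv H y))⁻¹ y :=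
  HasDerivAt.comp_const_add (H 0) y <| hasDerivAt_invFunOn isOpen_Ioo hH.strictMonoOn_Ioo
    (fun _ hz => hH.hasDerivAt (Ioo_subset_Ico_self hz))
    (fun z hz => hH.deriv_pos z (Ioo_subset_Ico_self hz))
    (mem_of_superset (Ioi_mem_nhds (by linarith)) hH.Ioi_subset_image)

theorem tendsto_ratioInv_atTop (hH : IsHomoclinicRatio H) :
    Tendsto (ratioInv H) atTop (𝓝[<] 1) :=
  (tendsto_invFunOn_nhdsLT one_pos hH.strictMonoOn_Ioo
    (mem_of_superset (Ioi_mem_atTop _) hH.Ioi_subset_image)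
    fun z _ => eventually_gt_atTop (H z)).comp (tendsto_atTop_add_const_left _ _ tendsto_id)

theorem tendsto_ratioInv_nhdsGT (hH : IsHomoclinicRatio H) :
    Tendsto (ratioInv H) (𝓝[>] 0) (𝓝[>] 0) := by
  refine (tendsto_invFunOn_nhdsGT (l := 𝓝[>] (H 0)) one_pos hH.strictMonoOn_Ioo
    (mem_of_superset self_mem_nhdsWithin hH.Ioi_subset_image) fun z hz =>
      eventually_nhdsWithin_of_eventually_nhds (gt_mem_nhds (hH.zero_lt hz))).comp ?_
  simpa using (continuous_const_add (H 0)).continuousWithinAt.tendsto_nhdsWithin (x := 0)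
    (s := Ioi 0) (t := Ioi (H 0)) fun y hy => by simpa using hy

theorem orbit_mem (hH : IsHomoclinicRatio H) (hY : 0 < Y) (hσ : σ ∈ Ioo (-1 : ℝ) 1) :
    orbit H Y σ ∈ Ioo (0 : ℝ) 1 :=
  hH.ratioInv_mem (mul_pos hY (one_sub_sq_pos hσ))

theorem apply_orbit (hH : IsHomoclinicRatio H) (hY : 0 < Y) (hσ : σ ∈ Ioo (-1 : ℝ) 1) :
    H (orbit H Y σ) = H 0 + Y * (1 - σ ^ 2) :=
  hH.apply_ratioInv (mul_pos hY (one_sub_sq_pos hσ))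

theorem deriv_orbit_pos (hH : IsHomoclinicRatio H) (hY : 0 < Y) (hσ : σ ∈ Ioo (-1 : ℝ) 1) :
    0 < deriv H (orbit H Y σ) :=
  hH.deriv_pos _ (Ioo_subset_Ico_self (hH.orbit_mem hY hσ))

theorem hasDerivAt_orbit (hH : IsHomoclinicRatio H) (hY : 0 < Y) (hσ : σ ∈ Ioo (-1 : ℝ) 1) :
    HasDerivAt (orbit H Y) (-(2 * Y * σ) / deriv H (orbit H Y σ)) σ := by
  have hlevel : HasDerivAt (fun σ : ℝ => Y * (1 - σ ^ 2)) (-(2 * Y * σ)) σ := by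
    convert! ((hasDerivAt_pow 2 σ).const_sub 1).const_mul Y using 1
    simp
    ring
  convert! (hH.hasDerivAt_ratioInv (mul_pos hY (one_sub_sq_pos hσ))).comp σ hlevel using 1
  rw [orbit]
  ring

theorem tendsto_orbit (hH : IsHomoclinicRatio H) (hY : 0 < Y) {ι : Type*} {l : Filter ι}
    {τ : ι → ℝ} (hτ : ∀ᶠ i in l, τ i ∈ Ioo (-1 : ℝ) 1) (hlim : Tendsto (fun i => τ i ^ 2) l (𝓝 1)) :
    Tendsto (fun i => orbit H Y (τ i)) l (𝓝[>] 0) := by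
  refine hH.tendsto_ratioInv_nhdsGT.comp (tendsto_nhdsWithin_iff.2 ⟨?_, ?_⟩)
  · simpa using (hlim.const_sub 1).const_mul Y
  · exact hτ.mono fun i hi => mul_pos hY (one_sub_sq_pos hi)

theorem slowness_pos (hH : IsHomoclinicRatio H) (hY : 0 < Y) (hσ : σ ∈ Ioo (-1 : ℝ) 1) :
    0 < slowness H Y σ :=
  div_pos (mul_pos two_pos (Real.sqrt_pos.2 (mul_pos hY (add_pos hH.zero_pos hY))))
    (mul_pos (hH.orbit_mem hY hσ).1 (hH.deriv_orbit_pos hY hσ))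

theorem continuousOn_comp_orbit (hH : IsHomoclinicRatio H) (hY : 0 < Y) {f : ℝ → ℝ}
    (hf : ContinuousOn f (Ico 0 1)) : ContinuousOn (fun σ => f (orbit H Y σ)) (Ioo (-1) 1) :=
  hf.comp (HasDerivAt.continuousOn fun _ hσ => hH.hasDerivAt_orbit hY hσ)
    fun _ hσ => Ioo_subset_Ico_self (hH.orbit_mem hY hσ)

theorem continuousOn_slowness (hH : IsHomoclinicRatio H) (hY : 0 < Y) :
    ContinuousOn (slowness H Y) (Ioo (-1) 1) :=
  continuousOn_const.div
    (hH.continuousOn_comp_orbit hY (continuousOn_id.mul hH.continuousOn_deriv))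
    fun _ hσ => (mul_pos (hH.orbit_mem hY hσ).1 (hH.deriv_orbit_pos hY hσ)).ne'

theorem hasDerivAt_position (hH : IsHomoclinicRatio H) (hY : 0 < Y) (hσ : σ ∈ Ioo (-1 : ℝ) 1) :
    HasDerivAt (position H Y) (slowness H Y σ) σ := by
  have hcont := hH.continuousOn_slowness hY
  have hint : IntervalIntegrable (slowness H Y) volume 0 σ :=
    (hcont.mono (ordConnected_Ioo.uIcc_subset (by norm_num) hσ)).intervalIntegrable
  exact intervalIntegral.integral_hasDerivAt_right hint
    (hcont.stronglyMeasurableAtFilter isOpen_Ioo σ hσ) (hcont.continuousAt (isOpen_Ioo.mem_nhds hσ))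

theorem continuousOn_position (hH : IsHomoclinicRatio H) (hY : 0 < Y) :
    ContinuousOn (position H Y) (Ioo (-1) 1) :=
  HasDerivAt.continuousOn fun _ => hH.hasDerivAt_position hY

theorem strictMonoOn_position (hH : IsHomoclinicRatio H) (hY : 0 < Y) :
    StrictMonoOn (position H Y) (Ioo (-1) 1) :=
  strictMonoOn_of_hasDerivWithinAt_pos (convex_Ioo _ _) (hH.continuousOn_position hY)
    (fun _ hσ => (hH.hasDerivAt_position hY (interior_subset hσ)).hasDerivWithinAt)
    fun _ hσ => hH.slowness_pos hY (interior_subset hσ)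

-- The logarithmic derivative of the orbit is `-(σ / a) * slowness`, with `a` as below, so the sum
-- is increasing on `[0, 1)` while `log (orbit H Y σ)` diverges.
theorem monotoneOn_position_add_log_orbit (hH : IsHomoclinicRatio H) (hY : 0 < Y) :
    MonotoneOn (fun σ => position H Y σ + √(Y * (H 0 + Y)) / Y * Real.log (orbit H Y σ))
      (Ico 0 1) := by
  have hd : ∀ σ ∈ Ico (0 : ℝ) 1,
      HasDerivAt (fun σ => position H Y σ + √(Y * (H 0 + Y)) / Y * Real.log (orbit H Y σ))
        (slowness H Y σ * (1 - σ)) σ := fun σ hσ => by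
    have hσ' : σ ∈ Ioo (-1 : ℝ) 1 := ⟨by linarith [hσ.1], hσ.2⟩
    have horbit := (hH.orbit_mem hY hσ').1.ne'
    have hderiv := (hH.deriv_orbit_pos hY hσ').ne'
    convert! (hH.hasDerivAt_position hY hσ').add
      (((hH.hasDerivAt_orbit hY hσ').log horbit).const_mul (√(Y * (H 0 + Y)) / Y)) using 1
    rw [slowness]
    field_simp
    ring
  refine monotoneOn_of_hasDerivWithinAt_nonneg (convex_Ico 0 1) (HasDerivAt.continuousOn hd)
    (fun σ hσ => (hd σ (interior_subset hσ)).hasDerivWithinAt) fun σ hσ => ?_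
  obtain ⟨hσ0, hσ1⟩ := interior_subset hσ
  exact mul_nonneg (hH.slowness_pos hY ⟨by linarith, hσ1⟩).le (sub_nonneg.2 hσ1.le)

theorem tendsto_position_nhdsLT (hH : IsHomoclinicRatio H) (hY : 0 < Y) :
    Tendsto (position H Y) (𝓝[<] 1) atTop := by
  set a := √(Y * (H 0 + Y)) / Y
  have ha : 0 < a := div_pos (Real.sqrt_pos.2 (mul_pos hY (add_pos hH.zero_pos hY))) hY
  have hsq : Tendsto (fun σ : ℝ => σ ^ 2) (𝓝[<] 1) (𝓝 1) := by
    simpa using ((continuous_pow 2).tendsto (1 : ℝ)).mono_left nhdsWithin_le_nhds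
  have horbit : Tendsto (orbit H Y) (𝓝[<] 1) (𝓝[>] 0) :=
    hH.tendsto_orbit hY (Ioo_mem_nhdsLT (by norm_num)) hsq
  have hlog : Tendsto (fun σ => a * Real.log (orbit H Y 0) - a * Real.log (orbit H Y σ)) (𝓝[<] 1)
      atTop := by
    refine tendsto_atTop_add_const_left _ _ (tendsto_neg_atBot_atTop.comp ?_)
    exact (Real.tendsto_log_nhdsGT_zero.comp horbit).const_mul_atBot ha
  refine tendsto_atTop_mono' _ ?_ hlog
  filter_upwards [Ioo_mem_nhdsLT one_pos] with σ hσ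
  have := hH.monotoneOn_position_add_log_orbit hY ⟨le_rfl, one_pos⟩ (Ioo_subset_Ico_self hσ) hσ.1.le
  simp only [position_zero] at this
  linarith

theorem image_position (hH : IsHomoclinicRatio H) (hY : 0 < Y) :
    position H Y '' Ioo (-1) 1 = univ := by
  have hright := hH.tendsto_position_nhdsLT hY
  have hleft : Tendsto (position H Y) (𝓝[>] (-1)) atBot := by
    have hreflect : Tendsto (fun σ : ℝ => -σ) (𝓝[>] (-1)) (𝓝[<] 1) := by
      simpa using tendsto_neg_nhdsGT (a := (-1 : ℝ))
    refine (tendsto_neg_atTop_atBot.comp (hright.comp hreflect)).congr fun σ => ?_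
    simp [position_neg]
  exact eq_univ_of_univ_subset <| isPreconnected_Ioo.intermediate_value_Iii
    (le_principal_iff.2 (Ioo_mem_nhdsGT (by norm_num)))
    (le_principal_iff.2 (Ioo_mem_nhdsLT (by norm_num))) (hH.continuousOn_position hY) hleft hright

theorem parameter_mem (hH : IsHomoclinicRatio H) (hY : 0 < Y) (x : ℝ) :
    parameter H Y x ∈ Ioo (-1 : ℝ) 1 :=
  Function.invFunOn_mem ((hH.image_position hY).ge (mem_univ x))

theorem parameter_position (hH : IsHomoclinicRatio H) (hY : 0 < Y) (hσ : σ ∈ Ioo (-1 : ℝ) 1) :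
    parameter H Y (position H Y σ) = σ :=
  (hH.strictMonoOn_position hY).injOn.leftInvOn_invFunOn hσ

theorem parameter_zero (hH : IsHomoclinicRatio H) (hY : 0 < Y) : parameter H Y 0 = 0 := by
  simpa only [position_zero] using hH.parameter_position hY (σ := 0) (by norm_num)

theorem hasDerivAt_parameter (hH : IsHomoclinicRatio H) (hY : 0 < Y) (x : ℝ) :
    HasDerivAt (parameter H Y) (slowness H Y (parameter H Y x))⁻¹ x :=
  hasDerivAt_invFunOn isOpen_Ioo (hH.strictMonoOn_position hY)
    (fun _ hσ => hH.hasDerivAt_position hY hσ) (fun _ hσ => hH.slowness_pos hY hσ)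
    (hH.image_position hY ▸ univ_mem)

theorem tendsto_parameter_atTop (hH : IsHomoclinicRatio H) (hY : 0 < Y) :
    Tendsto (parameter H Y) atTop (𝓝 1) :=
  (tendsto_invFunOn_nhdsLT (by norm_num) (hH.strictMonoOn_position hY)
    (hH.image_position hY ▸ univ_mem) fun σ _ => eventually_gt_atTop (position H Y σ)).mono_right
    nhdsWithin_le_nhds

theorem tendsto_parameter_atBot (hH : IsHomoclinicRatio H) (hY : 0 < Y) :
    Tendsto (parameter H Y) atBot (𝓝 (-1)) :=
  (tendsto_invFunOn_nhdsGT (by norm_num) (hH.strictMonoOn_position hY)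
    (hH.image_position hY ▸ univ_mem) fun σ _ => eventually_lt_atBot (position H Y σ)).mono_right
    nhdsWithin_le_nhds

theorem profile_mem (hH : IsHomoclinicRatio H) (hY : 0 < Y) (x : ℝ) :
    profile H Y x ∈ Ioo (0 : ℝ) 1 :=
  hH.orbit_mem hY (hH.parameter_mem hY x)

theorem profile_zero (hH : IsHomoclinicRatio H) (hY : 0 < Y) : profile H Y 0 = ratioInv H Y := by
  simp [profile, hH.parameter_zero hY, orbit]

theorem tendsto_profile_atTop (hH : IsHomoclinicRatio H) (hY : 0 < Y) :
    Tendsto (profile H Y) atTop (𝓝 0) :=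
  (hH.tendsto_orbit hY (Eventually.of_forall (hH.parameter_mem hY))
    (by simpa using (hH.tendsto_parameter_atTop hY).pow 2)).mono_right nhdsWithin_le_nhds

theorem tendsto_profile_atBot (hH : IsHomoclinicRatio H) (hY : 0 < Y) :
    Tendsto (profile H Y) atBot (𝓝 0) :=
  (hH.tendsto_orbit hY (Eventually.of_forall (hH.parameter_mem hY))
    (by simpa using (hH.tendsto_parameter_atBot hY).pow 2)).mono_right nhdsWithin_le_nhds

theorem hasDerivAt_profile (hH : IsHomoclinicRatio H) (hY : 0 < Y) (x : ℝ) :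
    HasDerivAt (profile H Y)
      (-(Y / √(Y * (H 0 + Y))) * (parameter H Y x * profile H Y x)) x := by
  have hτ := hH.parameter_mem hY x
  have horbit := (hH.orbit_mem hY hτ).1.ne'
  have hderiv := (hH.deriv_orbit_pos hY hτ).ne'
  have hroot : √(Y * (H 0 + Y)) ≠ 0 :=
    (Real.sqrt_pos.2 (mul_pos hY (add_pos hH.zero_pos hY))).ne'
  convert! (hH.hasDerivAt_orbit hY hτ).comp x (hH.hasDerivAt_parameter hY x) using 1
  rw [slowness, profile]
  field_simp

theorem hasDerivAt_deriv_profile (hH : IsHomoclinicRatio H) (hY : 0 < Y) (x : ℝ) :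
    HasDerivAt (fun x => -(Y / √(Y * (H 0 + Y))) * (parameter H Y x * profile H Y x))
      (profile H Y x - (H 0 + Y)⁻¹ *
        (profile H Y x * H (profile H Y x) + profile H Y x ^ 2 * deriv H (profile H Y x) / 2))
      x := by
  have hτ := hH.parameter_mem hY x
  have hsum : 0 < H 0 + Y := add_pos hH.zero_pos hY
  have hprofile := (hH.profile_mem hY x).1.ne'
  have hderiv : deriv H (profile H Y x) ≠ 0 := (hH.deriv_orbit_pos hY hτ).ne'
  have hlevel : H (profile H Y x) = H 0 + Y * (1 - parameter H Y x ^ 2) := hH.apply_orbit hY hτ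
  have hslow : slowness H Y (parameter H Y x) =
      2 * √(Y * (H 0 + Y)) / (profile H Y x * deriv H (profile H Y x)) := rfl
  convert! ((hH.hasDerivAt_parameter hY x).mul (hH.hasDerivAt_profile hY x)).const_mul
    (-(Y / √(Y * (H 0 + Y)))) using 1
  have hroot : √(Y * (H 0 + Y)) ^ 2 = Y * (H 0 + Y) := Real.sq_sqrt (by positivity)
  have hroot_ne : √(Y * (H 0 + Y)) ≠ 0 := (Real.sqrt_pos.2 (mul_pos hY hsum)).ne'
  rw [hlevel, hslow]
  generalize √(Y * (H 0 + Y)) = N at hroot hroot_ne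
  generalize profile H Y x = z at *
  trans Y / N ^ 2 * (Y * parameter H Y x ^ 2 * z - z ^ 2 * deriv H z / 2)
  · rw [hroot]
    field_simp
    ring
  · field_simp
    ring


theorem exists_bound_comp_ratioInv (hH : IsHomoclinicRatio H) (hY : 0 < Y) {f : ℝ → ℝ}
    (hf : ContinuousOn f (Ico 0 1)) : ∃ C, ∀ y ∈ Ioc 0 Y, ‖f (ratioInv H y)‖ ≤ C := by
  obtain ⟨C, hC⟩ := isCompact_Icc.exists_bound_of_continuousOn
    (hf.mono (Icc_subset_Ico_right (hH.ratioInv_mem hY).2))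
  exact ⟨C, fun y hy => hC _
    ⟨(hH.ratioInv_mem hy.1).1.le, hH.strictMonoOn_ratioInv.monotoneOn hy.1 hY hy.2⟩⟩

theorem exists_bound_comp_orbit (hH : IsHomoclinicRatio H) (hY : 0 < Y) {f : ℝ → ℝ}
    (hf : ContinuousOn f (Ico 0 1)) :
    ∃ C, ∀ y ∈ Ioc 0 Y, ∀ σ ∈ Ioo (-1 : ℝ) 1, ‖f (orbit H y σ)‖ ≤ C := by
  obtain ⟨C, hC⟩ := hH.exists_bound_comp_ratioInv hY hf
  exact ⟨C, fun y hy σ hσ => hC _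
    ⟨mul_pos hy.1 (one_sub_sq_pos hσ), by nlinarith [sq_nonneg σ, hy.1, hy.2]⟩⟩

theorem aestronglyMeasurable_comp_orbit (hH : IsHomoclinicRatio H) (hY : 0 < Y) {f : ℝ → ℝ}
    (hf : ContinuousOn f (Ico 0 1)) :
    AEStronglyMeasurable (fun σ => f (orbit H Y σ)) (volume.restrict (Ioo (-1) 1)) :=
  (hH.continuousOn_comp_orbit hY hf).aestronglyMeasurable measurableSet_Ioo

theorem integrableOn_comp_orbit (hH : IsHomoclinicRatio H) (hY : 0 < Y) {f : ℝ → ℝ}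
    (hf : ContinuousOn f (Ico 0 1)) : IntegrableOn (fun σ => f (orbit H Y σ)) (Ioo (-1) 1) := by
  obtain ⟨C, hC⟩ := hH.exists_bound_comp_orbit hY hf
  exact IntegrableOn.of_bound (by simp) (hH.aestronglyMeasurable_comp_orbit hY hf) C <|
    ae_restrict_of_forall_mem measurableSet_Ioo (hC Y ⟨hY, le_rfl⟩)

theorem slowness_smul_comp_profile (hH : IsHomoclinicRatio H) (hY : 0 < Y)
    (hσ : σ ∈ Ioo (-1 : ℝ) 1) (W : ℝ → ℝ) :
    |slowness H Y σ| • (fun z => z * deriv H z * W z) (profile H Y (position H Y σ)) =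
      2 * √(Y * (H 0 + Y)) * W (orbit H Y σ) := by
  have horbit := (hH.orbit_mem hY hσ).1.ne'
  have hderiv := (hH.deriv_orbit_pos hY hσ).ne'
  rw [abs_of_pos (hH.slowness_pos hY hσ), profile, hH.parameter_position hY hσ, slowness,
    smul_eq_mul]
  field_simp

theorem integrable_comp_profile (hH : IsHomoclinicRatio H) (hY : 0 < Y) {W : ℝ → ℝ}
    (hW : ContinuousOn W (Ico 0 1)) :
    Integrable fun x => (fun z => z * deriv H z * W z) (profile H Y x) := by
  rw [← integrableOn_univ, ← hH.image_position hY,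
    integrableOn_image_iff_integrableOn_abs_deriv_smul measurableSet_Ioo
      (fun _ hσ => (hH.hasDerivAt_position hY hσ).hasDerivWithinAt)
      (hH.strictMonoOn_position hY).injOn]
  exact IntegrableOn.congr_fun ((hH.integrableOn_comp_orbit hY hW).const_mul _)
    (fun σ hσ => (hH.slowness_smul_comp_profile hY hσ W).symm) measurableSet_Ioo

theorem integral_comp_profile (hH : IsHomoclinicRatio H) (hY : 0 < Y) (W : ℝ → ℝ) :
    ∫ x, (fun z => z * deriv H z * W z) (profile H Y x) = profileIntegral H W Y := by
  rw [← setIntegral_univ, ← hH.image_position hY,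
    integral_image_eq_integral_abs_deriv_smul measurableSet_Ioo
      (fun _ hσ => (hH.hasDerivAt_position hY hσ).hasDerivWithinAt)
      (hH.strictMonoOn_position hY).injOn, profileIntegral, ← integral_const_mul]
  exact setIntegral_congr_fun measurableSet_Ioo fun σ hσ =>
    hH.slowness_smul_comp_profile hY hσ W

theorem continuousOn_logSlope (hH : IsHomoclinicRatio H)
    (hW : ∀ z ∈ Ico (0 : ℝ) 1, ContDiffAt ℝ 1 W z) : ContinuousOn (logSlope H W) (Ico 0 1) :=
  (hH.continuousOn.sub continuousOn_const).mul <|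
    (continuousOn_deriv_of_contDiffAt hW).div hH.continuousOn_deriv
      fun z hz => (hH.deriv_pos z hz).ne'

theorem hasDerivAt_comp_orbit (hH : IsHomoclinicRatio H) (hY : 0 < Y) (hσ : σ ∈ Ioo (-1 : ℝ) 1)
    (hW : ∀ z ∈ Ico (0 : ℝ) 1, ContDiffAt ℝ 1 W z) :
    HasDerivAt (fun Y => W (orbit H Y σ)) (logSlope H W (orbit H Y σ) / Y) Y := by
  have hW' := (hW _ (Ioo_subset_Ico_self (hH.orbit_mem hY hσ))).differentiableAt one_ne_zero
  have horbit : HasDerivAt (fun Y => orbit H Y σ) _ Y :=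
    (hH.hasDerivAt_ratioInv (mul_pos hY (one_sub_sq_pos hσ))).comp Y (hasDerivAt_mul_const _)
  convert! hW'.hasDerivAt.comp Y horbit using 1
  rw [logSlope, hH.apply_orbit hY hσ, orbit]
  field_simp
  ring

theorem hasDerivAt_integral_comp_orbit (hH : IsHomoclinicRatio H) (hY : 0 < Y)
    (hW : ∀ z ∈ Ico (0 : ℝ) 1, ContDiffAt ℝ 1 W z) :
    HasDerivAt (fun Y => ∫ σ in Ioo (-1) 1, W (orbit H Y σ))
      ((∫ σ in Ioo (-1) 1, logSlope H W (orbit H Y σ)) / Y) Y := by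
  have hcont : ContinuousOn W (Ico 0 1) := fun z hz => (hW z hz).continuousAt.continuousWithinAt
  have hslope := hH.continuousOn_logSlope hW
  have hY2 : 0 < 2 * Y := by positivity
  obtain ⟨C, hC⟩ := hH.exists_bound_comp_orbit hY2 hslope
  rw [← integral_div]
  refine (hasDerivAt_integral_of_dominated_loc_of_deriv_le (F := fun Y σ => W (orbit H Y σ))
    (F' := fun Y σ => logSlope H W (orbit H Y σ) / Y) (bound := fun _ => C / (Y / 2))
    (Ioo_mem_nhds (half_lt_self hY) (lt_two_mul_self hY)) ?_
    (hH.integrableOn_comp_orbit hY hcont)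
    ((hH.aestronglyMeasurable_comp_orbit hY hslope).div₀ aestronglyMeasurable_const)
    (ae_restrict_of_forall_mem measurableSet_Ioo fun σ hσ y hy => ?_) (integrable_const _)
    (ae_restrict_of_forall_mem measurableSet_Ioo fun σ hσ y hy =>
      hH.hasDerivAt_comp_orbit ((half_pos hY).trans hy.1) hσ hW)).2
  · filter_upwards [Ioi_mem_nhds hY] with y hy
    exact hH.aestronglyMeasurable_comp_orbit hy hcont
  · have hy0 : 0 < y := (half_pos hY).trans hy.1
    have hbound := hC y ⟨hy0, hy.2.le⟩ σ hσ
    rw [norm_div, Real.norm_of_nonneg hy0.le]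
    exact div_le_div₀ ((norm_nonneg _).trans hbound) hbound (half_pos hY) hy.1.le

theorem integral_comp_orbit_pos (hH : IsHomoclinicRatio H) (hY : 0 < Y)
    (hW : ContinuousOn W (Ico 0 1)) (hpos : ∀ z ∈ Ioo (0 : ℝ) 1, 0 < W z) :
    0 < ∫ σ in Ioo (-1) 1, W (orbit H Y σ) := by
  have hpos' : ∀ σ ∈ Ioo (-1 : ℝ) 1, 0 < W (orbit H Y σ) :=
    fun σ hσ => hpos _ (hH.orbit_mem hY hσ)
  rw [setIntegral_pos_iff_support_of_nonneg_ae
    (ae_restrict_of_forall_mem measurableSet_Ioo fun σ hσ => (hpos' σ hσ).le)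
    (hH.integrableOn_comp_orbit hY hW)]
  have hsub : Ioo (-1 : ℝ) 1 ⊆ Function.support (fun σ => W (orbit H Y σ)) ∩ Ioo (-1) 1 :=
    fun σ hσ => ⟨(hpos' σ hσ).ne', hσ⟩
  exact lt_of_lt_of_le (by simp) (measure_mono hsub)

theorem exists_hasDerivAt_profileIntegral (hH : IsHomoclinicRatio H) (hY : 0 < Y)
    (hW : ∀ z ∈ Ico (0 : ℝ) 1, ContDiffAt ℝ 1 W z)
    (hI : 0 < ∫ σ in Ioo (-1) 1, W (orbit H Y σ))
    (hIJ : 0 < (∫ σ in Ioo (-1) 1, W (orbit H Y σ)) / 2 +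
      ∫ σ in Ioo (-1) 1, logSlope H W (orbit H Y σ)) :
    ∃ d > 0, HasDerivAt (profileIntegral H W) d Y := by
  have hbase := hH.zero_pos
  have hprod : 0 < Y * (H 0 + Y) := by positivity
  have hd : HasDerivAt (fun Y => Y * (H 0 + Y)) (H 0 + 2 * Y) Y := by
    convert! (hasDerivAt_id Y).mul ((hasDerivAt_id Y).const_add (H 0)) using 1
    simp
    ring
  refine ⟨_, ?_, ((hd.sqrt hprod.ne').const_mul 2).mul (hH.hasDerivAt_integral_comp_orbit hY hW)⟩
  have hroot : √(Y * (H 0 + Y)) ^ 2 = Y * (H 0 + Y) := Real.sq_sqrt hprod.le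
  have hroot_pos : 0 < √(Y * (H 0 + Y)) := Real.sqrt_pos.2 hprod
  set I := ∫ σ in Ioo (-1) 1, W (orbit H Y σ)
  set J := ∫ σ in Ioo (-1) 1, logSlope H W (orbit H Y σ)
  have hsplit : 2 * ((H 0 + 2 * Y) / (2 * √(Y * (H 0 + Y)))) * I +
      2 * √(Y * (H 0 + Y)) * (J / Y) =
        (2 * (H 0 + Y) * (I / 2 + J) + Y * I) / √(Y * (H 0 + Y)) := by
    field_simp
    rw [hroot]
    ring
  rw [hsplit]
  positivity

theorem eventually_exists_hasDerivAt_profileIntegral_nhdsGT (hH : IsHomoclinicRatio H)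
    (hW : ∀ z ∈ Ico (0 : ℝ) 1, ContDiffAt ℝ 1 W z) (hpos : ∀ z ∈ Ioo (0 : ℝ) 1, 0 < W z)
    (hW' : ∀ᶠ z in 𝓝[>] 0, 0 < deriv W z) :
    ∀ᶠ Y in 𝓝[>] 0, ∃ d > 0, HasDerivAt (profileIntegral H W) d Y := by
  obtain ⟨ε, hε, hsub⟩ :=
    mem_nhdsGT_iff_exists_Ioo_subset.1 (hH.tendsto_ratioInv_nhdsGT.eventually hW')
  filter_upwards [Ioo_mem_nhdsGT hε] with Y hY
  have hcont : ContinuousOn W (Ico 0 1) := fun z hz => (hW z hz).continuousAt.continuousWithinAt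
  have hI := hH.integral_comp_orbit_pos hY.1 hcont hpos
  have hJ : 0 ≤ ∫ σ in Ioo (-1) 1, logSlope H W (orbit H Y σ) := by
    refine setIntegral_nonneg measurableSet_Ioo fun σ hσ => ?_
    have hlevel := mul_pos hY.1 (one_sub_sq_pos hσ)
    have hderiv : 0 < deriv W (orbit H Y σ) :=
      hsub ⟨hlevel, lt_of_le_of_lt (by nlinarith [sq_nonneg σ, hY.1]) hY.2⟩
    rw [logSlope, hH.apply_orbit hY.1 hσ, add_sub_cancel_left]
    exact (mul_pos hlevel (div_pos hderiv (hH.deriv_orbit_pos hY.1 hσ))).le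
  exact hH.exists_hasDerivAt_profileIntegral hY.1 hW hI (by linarith)

theorem tendsto_integral_comp_orbit_atTop (hH : IsHomoclinicRatio H) {f : ℝ → ℝ} {L : ℝ}
    (hf : ContinuousOn f (Ico 0 1)) (hL : Tendsto f (𝓝[<] 1) (𝓝 L)) :
    Tendsto (fun Y => ∫ σ in Ioo (-1) 1, f (orbit H Y σ)) atTop (𝓝 (2 * L)) := by
  have hlim := hL.comp hH.tendsto_ratioInv_atTop
  obtain ⟨y₁, hy₁⟩ := eventually_atTop.1 (hlim.norm.eventually (gt_mem_nhds (lt_add_one ‖L‖)))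
  obtain ⟨C, hC⟩ := hH.exists_bound_comp_ratioInv (lt_max_of_lt_right one_pos : 0 < max y₁ 1) hf
  have hbound : ∀ y, 0 < y → ‖f (ratioInv H y)‖ ≤ max C (‖L‖ + 1) := fun y hy => by
    rcases le_total y (max y₁ 1) with hle | hge
    · exact le_max_of_le_left (hC y ⟨hy, hle⟩)
    · exact le_max_of_le_right (hy₁ y ((le_max_left _ _).trans hge)).le
  have hconst : ∫ _ in Ioo (-1 : ℝ) 1, L = 2 * L := by
    simp
    norm_num
  rw [← hconst]
  refine tendsto_integral_filter_of_dominated_convergence (fun _ => max C (‖L‖ + 1)) ?_ ?_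
    (integrable_const _) (ae_restrict_of_forall_mem measurableSet_Ioo fun σ hσ =>
      hlim.comp (tendsto_id.atTop_mul_const (one_sub_sq_pos hσ)))
  · filter_upwards [eventually_gt_atTop 0] with Y hY
    exact hH.aestronglyMeasurable_comp_orbit hY hf
  · filter_upwards [eventually_gt_atTop 0] with Y hY
    exact ae_restrict_of_forall_mem measurableSet_Ioo fun σ hσ =>
      hbound _ (mul_pos hY (one_sub_sq_pos hσ))

theorem eventually_exists_hasDerivAt_profileIntegral_atTop (hH : IsHomoclinicRatio H) {L : ℝ}
    (hW : ∀ z ∈ Ico (0 : ℝ) 1, ContDiffAt ℝ 1 W z) (hL : 0 < L)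
    (hlim : Tendsto W (𝓝[<] 1) (𝓝 L)) (hslope : Tendsto (logSlope H W) (𝓝[<] 1) (𝓝 0)) :
    ∀ᶠ Y in atTop, ∃ d > 0, HasDerivAt (profileIntegral H W) d Y := by
  have hI := hH.tendsto_integral_comp_orbit_atTop
    (fun z hz => (hW z hz).continuousAt.continuousWithinAt) hlim
  have hJ := hH.tendsto_integral_comp_orbit_atTop (hH.continuousOn_logSlope hW) hslope
  filter_upwards [eventually_gt_atTop 0, hI.eventually_const_lt (by positivity),
    ((hI.div_const 2).add hJ).eventually_const_lt (u := 0) (by simpa using hL)] with Y hY hY₁ hY₂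
  exact hH.exists_hasDerivAt_profileIntegral hY hW hY₁ hY₂

theorem tendsto_profileIntegral_atTop (hH : IsHomoclinicRatio H) {L : ℝ}
    (hW : ContinuousOn W (Ico 0 1)) (hL : 0 < L) (hlim : Tendsto W (𝓝[<] 1) (𝓝 L)) :
    Tendsto (profileIntegral H W) atTop atTop := by
  refine Tendsto.atTop_mul_pos (mul_pos two_pos hL) (Tendsto.const_mul_atTop two_pos ?_)
    (hH.tendsto_integral_comp_orbit_atTop hW hlim)
  refine tendsto_atTop_mono' _ ?_ tendsto_id
  filter_upwards [eventually_gt_atTop 0] with Y hY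
  exact Real.le_sqrt_of_sq_le (by simp only [id]; nlinarith [hH.zero_pos])

end IsHomoclinicRatio

end Homoclinic

/-! ### The potential and the density of the functional -/

/-- The potential of the normalized equation: its derivative is `force`. -/
def pot (b z : ℝ) : ℝ := ((1 - z) ^ (1 - b) - 1) / (b - 1) - z

/-- The nonlinearity of the normalized equation `z'' = z - κ * force b z`. -/
def force (b z : ℝ) : ℝ := (1 - z) ^ (-b) - 1

/-- The negative of the integrand of `Q` in the normalized variable `z = (φ - k) / (c - k)`. -/
def dens (b z : ℝ) : ℝ := (1 - z) ^ (-b) - b * (1 - z) ^ (-1 : ℝ) + b - 1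

/-- The function `2 * pot b z / z ^ 2`, continued to `z = 0`. -/
def ratio (b z : ℝ) : ℝ := 2 * sqQuot (pot b) z

/-- The weight for which `dens b z = z * deriv (ratio b) z * weight b z`. -/
def weight (b z : ℝ) : ℝ := z * sqQuot (dens b) z / deriv (ratio b) z

section Potential

variable {b z : ℝ}

theorem hasDerivAt_pot (hb : b ≠ 1) (hz : z < 1) : HasDerivAt (pot b) (force b z) z := by
  have hb' : b - 1 ≠ 0 := sub_ne_zero.2 hb
  convert! (((hasDerivAt_one_sub_rpow (1 - b) hz).sub_const 1).div_const (b - 1)).sub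
    (hasDerivAt_id z) using 1
  rw [force, show 1 - b - 1 = -b by ring]
  field_simp
  ring

theorem hasDerivAt_force (b : ℝ) (hz : z < 1) :
    HasDerivAt (force b) (b * (1 - z) ^ (-b - 1)) z := by
  convert! (hasDerivAt_one_sub_rpow (-b) hz).sub_const 1 using 1
  ring

theorem hasDerivAt_deriv_force (b : ℝ) (hz : z < 1) :
    HasDerivAt (fun z : ℝ => b * (1 - z) ^ (-b - 1)) (b * (b + 1) * (1 - z) ^ (-b - 2)) z := by
  convert! (hasDerivAt_one_sub_rpow (-b - 1) hz).const_mul b using 1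
  rw [show -b - 1 - 1 = -b - 2 by ring]
  ring

theorem hasDerivAt_dens (b : ℝ) (hz : z < 1) :
    HasDerivAt (dens b) (b * (1 - z) ^ (-b - 1) - b * (1 - z) ^ (-2 : ℝ)) z := by
  convert! (((hasDerivAt_one_sub_rpow (-b) hz).sub
    ((hasDerivAt_one_sub_rpow (-1) hz).const_mul b)).add_const b).sub_const 1 using 1
  rw [show (-1 : ℝ) - 1 = -2 by norm_num]
  ring

theorem hasDerivAt_deriv_dens (b : ℝ) (hz : z < 1) :
    HasDerivAt (fun z : ℝ => b * (1 - z) ^ (-b - 1) - b * (1 - z) ^ (-2 : ℝ))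
      (b * (b + 1) * (1 - z) ^ (-b - 2) - 2 * b * (1 - z) ^ (-3 : ℝ)) z := by
  convert! (hasDerivAt_deriv_force b hz).sub
    ((hasDerivAt_one_sub_rpow (-2) hz).const_mul b) using 1
  rw [show (-2 : ℝ) - 1 = -3 by norm_num]
  ring

theorem analyticAt_pot (b : ℝ) (hz : z < 1) : AnalyticAt ℝ (pot b) z :=
  (((analyticAt_one_sub_rpow (1 - b) hz).sub analyticAt_const).mul
    (analyticAt_const (v := (b - 1)⁻¹))).sub analyticAt_id

theorem analyticAt_force (b : ℝ) (hz : z < 1) : AnalyticAt ℝ (force b) z :=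
  (analyticAt_one_sub_rpow (-b) hz).sub analyticAt_const

theorem analyticAt_dens (b : ℝ) (hz : z < 1) : AnalyticAt ℝ (dens b) z :=
  (((analyticAt_one_sub_rpow (-b) hz).sub (analyticAt_const.mul
    (analyticAt_one_sub_rpow (-1) hz))).add analyticAt_const).sub analyticAt_const

theorem pot_zero (b : ℝ) : pot b 0 = 0 := by simp [pot]

theorem force_zero (b : ℝ) : force b 0 = 0 := by simp [force]

theorem dens_zero (b : ℝ) : dens b 0 = 0 := by simp [dens]

theorem hasDerivAt_pot_zero (hb : b ≠ 1) : HasDerivAt (pot b) 0 0 := by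
  simpa only [force_zero] using hasDerivAt_pot hb one_pos

theorem hasDerivAt_dens_zero (b : ℝ) : HasDerivAt (dens b) 0 0 := by
  simpa using hasDerivAt_dens b one_pos

theorem two_mul_pot_le (hb : 1 < b) (hz : z ≤ 0) : 2 * pot b z ≤ b * z ^ 2 := by
  have hlt : ∀ x ∈ Iic (0 : ℝ), x < 1 := fun _ hx => hx.trans_lt one_pos
  have := half_mul_sq_le (m := -b) (convex_Iic 0) (mem_Iic.2 le_rfl)
    (fun x hx => (hasDerivAt_pot hb.ne' (hlt x hx)).neg)
    (fun x hx => (hasDerivAt_force b (hlt x hx)).neg)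
    (by simp [pot_zero]) (by simp [force_zero]) (fun x hx => ?_) hz
  · simp only [Pi.neg_apply] at this
    linarith
  · have hpow : (1 - x) ^ (-b - 1) ≤ 1 :=
      Real.rpow_le_one_of_one_le_of_nonpos (by linarith [mem_Iic.1 hx]) (by linarith)
    exact neg_le_neg (mul_le_of_le_one_right (by linarith) hpow)

theorem sqQuot_dens_pos (hb : 1 < b) (hz : z ∈ Ico (0 : ℝ) 1) : 0 < sqQuot (dens b) z := by
  have hbb : 0 < b * (b - 1) := mul_pos (by linarith) (by linarith)
  refine (half_pos hbb).trans_le <| le_sqQuot (fun x hx => analyticAt_dens b hx.2)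
    (fun x hx => hasDerivAt_dens b hx.2) (fun x hx => hasDerivAt_deriv_dens b hx.2)
    (dens_zero b) (by simp) (fun x hx => ?_) hz
  have hone : 1 ≤ (1 - x) ^ (-3 : ℝ) := one_le_one_sub_rpow (by norm_num) hx
  have hexp : (1 - x) ^ (-3 : ℝ) ≤ (1 - x) ^ (-b - 2) :=
    Real.rpow_le_rpow_of_exponent_ge (by linarith [hx.2]) (by linarith [hx.1]) (by linarith)
  calc b * (b - 1) ≤ b * (b - 1) * (1 - x) ^ (-3 : ℝ) := le_mul_of_one_le_right hbb.le hone
    _ = b * (b + 1) * (1 - x) ^ (-3 : ℝ) - 2 * b * (1 - x) ^ (-3 : ℝ) := by ring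
    _ ≤ b * (b + 1) * (1 - x) ^ (-b - 2) - 2 * b * (1 - x) ^ (-3 : ℝ) := by gcongr

theorem analyticAt_ratio (b : ℝ) (hz : z < 1) : AnalyticAt ℝ (ratio b) z :=
  analyticAt_const.mul (analyticAt_sqQuot (analyticAt_pot b one_pos) (analyticAt_pot b hz))

theorem sq_mul_ratio (hb : b ≠ 1) (z : ℝ) : z ^ 2 * ratio b z = 2 * pot b z := by
  rw [ratio, ← sq_mul_sqQuot (pot_zero b) (hasDerivAt_pot_zero hb) z]
  ring

theorem deriv_ratio (b : ℝ) (hz : z < 1) : deriv (ratio b) z = 2 * deriv (sqQuot (pot b)) z :=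
  ((hasDerivAt_sqQuot (analyticAt_pot b one_pos) (analyticAt_pot b hz)).const_mul 2).deriv

theorem force_eq_ratio (hb : b ≠ 1) (hz : z < 1) :
    force b z = z * ratio b z + z ^ 2 * deriv (ratio b) z / 2 := by
  rw [← (hasDerivAt_pot hb hz).deriv, deriv_eq_sqQuot (pot_zero b) (hasDerivAt_pot_zero hb)
    (analyticAt_pot b one_pos) (analyticAt_pot b hz), deriv_ratio b hz, ratio]
  ring

theorem ratio_zero (hb : b ≠ 1) : ratio b 0 = b := by
  have hderiv : deriv (pot b) =ᶠ[𝓝 0] force b :=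
    (gt_mem_nhds one_pos).mono fun z hz => (hasDerivAt_pot hb hz).deriv
  rw [ratio, sqQuot_zero (pot_zero b) (hasDerivAt_pot_zero hb) (analyticAt_pot b one_pos),
    hderiv.deriv_eq, (hasDerivAt_force b one_pos).deriv]
  simp
  ring

theorem ratio_le (hb : 1 < b) (hz : z ≤ 0) : ratio b z ≤ b := by
  rcases hz.eq_or_lt with rfl | hneg
  · exact (ratio_zero hb.ne').le
  · have hpot := two_mul_pot_le hb hz
    rw [← sq_mul_ratio hb.ne', mul_comm b] at hpot
    exact le_of_mul_le_mul_left hpot (sq_pos_of_neg hneg)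

theorem deriv_ratio_pos (hb : 1 < b) (hz : z ∈ Ico (0 : ℝ) 1) : 0 < deriv (ratio b) z := by
  have hlower : b * (b + 1) / 6 ≤ deriv (sqQuot (pot b)) z :=
    le_deriv_sqQuot (fun x hx => analyticAt_pot b hx.2) (fun x hx => hasDerivAt_pot hb.ne' hx.2)
      (fun x hx => hasDerivAt_force b hx.2) (fun x hx => hasDerivAt_deriv_force b hx.2)
      (pot_zero b) (force_zero b) (fun x hx => le_mul_of_one_le_right (by positivity)
        (one_le_one_sub_rpow (by linarith) hx)) hz
  rw [deriv_ratio b hz.2]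
  exact mul_pos two_pos (lt_of_lt_of_le (by positivity) hlower)

theorem analyticAt_weight (hb : 1 < b) (hz : z ∈ Ico (0 : ℝ) 1) : AnalyticAt ℝ (weight b) z :=
  (analyticAt_id.mul (analyticAt_sqQuot (analyticAt_dens b one_pos)
    (analyticAt_dens b hz.2))).fun_div (analyticAt_ratio b hz.2).deriv (deriv_ratio_pos hb hz).ne'

theorem weight_pos (hb : 1 < b) (hz : z ∈ Ioo (0 : ℝ) 1) : 0 < weight b z :=
  div_pos (mul_pos hz.1 (sqQuot_dens_pos hb (Ioo_subset_Ico_self hz)))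
    (deriv_ratio_pos hb (Ioo_subset_Ico_self hz))

theorem dens_eq_weight (hb : 1 < b) (hz : z ∈ Ico (0 : ℝ) 1) :
    dens b z = z * deriv (ratio b) z * weight b z := by
  have hderiv := (deriv_ratio_pos hb hz).ne'
  rw [← sq_mul_sqQuot (dens_zero b) (hasDerivAt_dens_zero b) z, weight]
  field_simp

theorem eventually_deriv_weight_pos (hb : 1 < b) : ∀ᶠ z in 𝓝[>] 0, 0 < deriv (weight b) z := by
  have hmem : (0 : ℝ) ∈ Ico 0 1 := ⟨le_rfl, one_pos⟩
  have hratio := deriv_ratio_pos hb hmem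
  have hderiv : HasDerivAt (weight b) (sqQuot (dens b) 0 / deriv (ratio b) 0) 0 := by
    have han := analyticAt_dens b one_pos
    convert! ((hasDerivAt_id (0 : ℝ)).mul (hasDerivAt_sqQuot han han)).div
      (analyticAt_ratio b one_pos).deriv.differentiableAt.hasDerivAt hratio.ne' using 1
    simp
    field_simp
  refine nhdsWithin_le_nhds <|
    (analyticAt_weight hb hmem).deriv.continuousAt.eventually (lt_mem_nhds ?_)
  rw [hderiv.deriv]
  exact div_pos (sqQuot_dens_pos hb hmem) hratio

end Potential

/-! ### Behaviour at the peak -/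

/-- The value of `r * z ^ 2 * ratio b z` at `q = (z, r)`, where `r = (1 - z) ^ (b - 1)`. -/
def scaledRatio (b : ℝ) (q : ℝ × ℝ) : ℝ := 2 * ((1 - q.2) / (b - 1) - q.1 * q.2)

/-- The value of `(1 - z) * r * z ^ 3 * deriv (ratio b) z` at `q = (z, r)`, where
`r = (1 - z) ^ (b - 1)`. -/
def scaledDerivRatio (b : ℝ) (q : ℝ × ℝ) : ℝ :=
  2 * (q.1 * (1 - (1 - q.1) * q.2) - (1 - q.1) * scaledRatio b q)

/-- The value of `(1 - z) * r * dens b z` at `q = (z, r)`, where `r = (1 - z) ^ (b - 1)`. -/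
def scaledDens (b : ℝ) (q : ℝ × ℝ) : ℝ := 1 - b * q.2 + (b - 1) * ((1 - q.1) * q.2)

/-- The value of `weight b z` at `q = (z, r)`, where `r = (1 - z) ^ (b - 1)`. -/
def scaledWeight (b : ℝ) (q : ℝ × ℝ) : ℝ := q.1 ^ 2 * scaledDens b q / scaledDerivRatio b q

section Peak

variable {b z : ℝ}

theorem one_sub_rpow_neg (b : ℝ) (hz : z < 1) :
    (1 - z) ^ (-b) = ((1 - z) * (1 - z) ^ (b - 1))⁻¹ := by
  have hz' : 0 < 1 - z := sub_pos.2 hz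
  rw [Real.rpow_neg hz'.le, Real.rpow_sub_one hz'.ne']
  field_simp

theorem scaledRatio_eq (hb : b ≠ 1) (hz : z < 1) :
    scaledRatio b (z, (1 - z) ^ (b - 1)) = (1 - z) ^ (b - 1) * (z ^ 2 * ratio b z) := by
  have hz' : 0 < 1 - z := sub_pos.2 hz
  have hb' : b - 1 ≠ 0 := sub_ne_zero.2 hb
  have hr := (Real.rpow_pos_of_pos hz' (b - 1)).ne'
  rw [sq_mul_ratio hb, pot, scaledRatio, show 1 - b = -(b - 1) by ring, Real.rpow_neg hz'.le]
  field_simp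

theorem scaledDerivRatio_eq (hb : b ≠ 1) (hz : z < 1) :
    scaledDerivRatio b (z, (1 - z) ^ (b - 1)) =
      (1 - z) * (1 - z) ^ (b - 1) * (z ^ 3 * deriv (ratio b) z) := by
  have hz' : 0 < 1 - z := sub_pos.2 hz
  have hr := (Real.rpow_pos_of_pos hz' (b - 1)).ne'
  have hcube : z ^ 3 * deriv (ratio b) z = 2 * (z * force b z - z ^ 2 * ratio b z) := by
    rw [force_eq_ratio hb hz]
    ring
  rw [hcube, scaledDerivRatio, scaledRatio_eq hb hz, force, one_sub_rpow_neg b hz]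
  field_simp

theorem scaledDens_eq (b : ℝ) (hz : z < 1) :
    scaledDens b (z, (1 - z) ^ (b - 1)) = (1 - z) * (1 - z) ^ (b - 1) * dens b z := by
  have hz' : 0 < 1 - z := sub_pos.2 hz
  have hr := (Real.rpow_pos_of_pos hz' (b - 1)).ne'
  rw [dens, one_sub_rpow_neg b hz, Real.rpow_neg_one, scaledDens]
  field_simp
  ring

theorem weight_eq_scaledWeight (hb : 1 < b) (hz : z ∈ Ioo (0 : ℝ) 1) :
    weight b z = scaledWeight b (z, (1 - z) ^ (b - 1)) := by
  have hz' : 0 < 1 - z := sub_pos.2 hz.2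
  have hr := (Real.rpow_pos_of_pos hz' (b - 1)).ne'
  have hderiv := (deriv_ratio_pos hb (Ioo_subset_Ico_self hz)).ne'
  have hz0 := hz.1.ne'
  rw [scaledWeight, scaledDens_eq b hz.2, scaledDerivRatio_eq hb.ne' hz.2,
    dens_eq_weight hb (Ioo_subset_Ico_self hz)]
  field_simp

theorem contDiffAt_scaledWeight (b : ℝ) : ContDiffAt ℝ 1 (scaledWeight b) (1, 0) := by
  unfold scaledWeight scaledDens scaledDerivRatio scaledRatio
  exact ContDiffAt.div (by fun_prop) (by fun_prop) (by norm_num)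

theorem tendsto_ratio_nhdsLT (hb : 1 < b) : Tendsto (ratio b) (𝓝[<] 1) atTop := by
  have hcurve := tendsto_prodMk_one_sub_rpow (sub_pos.2 hb)
  have hnum : Tendsto (fun z : ℝ => scaledRatio b (z, (1 - z) ^ (b - 1)) / z ^ 2) (𝓝[<] 1)
      (𝓝 (2 / (b - 1))) := by
    have hcont : ContinuousAt (fun q : ℝ × ℝ => scaledRatio b q / q.1 ^ 2) (1, 0) := by
      unfold scaledRatio
      exact ContinuousAt.div (by fun_prop) (by fun_prop) (by norm_num)
    simpa [scaledRatio, div_eq_mul_inv, Function.comp_def] using hcont.tendsto.comp hcurve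
  have hpow : Tendsto (fun z : ℝ => (1 - z) ^ (-(b - 1))) (𝓝[<] 1) atTop :=
    (tendsto_rpow_neg_nhdsGT_zero (neg_lt_zero.2 (sub_pos.2 hb))).comp tendsto_one_sub_nhdsLT
  refine (Tendsto.pos_mul_atTop (div_pos two_pos (sub_pos.2 hb)) hnum hpow).congr' ?_
  filter_upwards [Ioo_mem_nhdsLT one_pos] with z hz
  have hz' : 0 < 1 - z := sub_pos.2 hz.2
  have hr := (Real.rpow_pos_of_pos hz' (b - 1)).ne'
  have hz0 := hz.1.ne'
  rw [scaledRatio_eq hb.ne' hz.2, Real.rpow_neg hz'.le]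
  field_simp

theorem isHomoclinicRatio_ratio (hb : 1 < b) : IsHomoclinicRatio (ratio b) where
  contDiffAt _ hz := (analyticAt_ratio b hz.2).contDiffAt
  deriv_pos _ hz := deriv_ratio_pos hb hz
  zero_pos := by rw [ratio_zero hb.ne']; exact one_pos.trans hb
  tendsto_atTop := tendsto_ratio_nhdsLT hb

theorem tendsto_weight_nhdsLT (hb : 1 < b) : Tendsto (weight b) (𝓝[<] 1) (𝓝 (1 / 2)) := by
  have hlim := (contDiffAt_scaledWeight b).continuousAt.tendsto.comp
    (tendsto_prodMk_one_sub_rpow (sub_pos.2 hb))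
  simp only [scaledWeight, scaledDens, scaledDerivRatio] at hlim
  refine (hlim.congr' ?_).trans (by norm_num)
  filter_upwards [Ioo_mem_nhdsLT one_pos] with z hz
  exact (weight_eq_scaledWeight hb hz).symm

-- Here `ratio` grows only as fast as `(1 - z) * deriv (ratio b) z`, while `(1 - z) * W'` tends to
-- zero because the weight `W` is differentiable in `z` and `(1 - z) ^ (b - 1)`.
theorem tendsto_logSlope_weight_nhdsLT (hb : 1 < b) :
    Tendsto (logSlope (ratio b) (weight b)) (𝓝[<] 1) (𝓝 0) := by
  have hcont : ContinuousAt (fun q : ℝ × ℝ =>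
      q.1 * (scaledRatio b q - b * q.1 ^ 2 * q.2) / scaledDerivRatio b q) (1, 0) := by
    unfold scaledDerivRatio scaledRatio
    exact ContinuousAt.div (by fun_prop) (by fun_prop) (by norm_num)
  have hlim := (hcont.tendsto.comp (tendsto_prodMk_one_sub_rpow (sub_pos.2 hb))).mul
    (tendsto_one_sub_mul_deriv_comp (sub_pos.2 hb) (contDiffAt_scaledWeight b))
  rw [mul_zero] at hlim
  refine hlim.congr' ?_
  filter_upwards [Ioo_mem_nhdsLT one_pos] with z hz
  have hweight : weight b =ᶠ[𝓝 z] fun x => scaledWeight b (x, (1 - x) ^ (b - 1)) :=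
    mem_of_superset (Ioo_mem_nhds hz.1 hz.2) fun x hx => weight_eq_scaledWeight hb hx
  have hz' : 0 < 1 - z := sub_pos.2 hz.2
  have hr := (Real.rpow_pos_of_pos hz' (b - 1)).ne'
  have hderiv := (deriv_ratio_pos hb (Ioo_subset_Ico_self hz)).ne'
  have hz0 := hz.1.ne'
  simp only [Function.comp_def]
  rw [← hweight.deriv_eq, logSlope, ratio_zero hb.ne', scaledRatio_eq hb.ne' hz.2,
    scaledDerivRatio_eq hb.ne' hz.2]
  field_simp

end Peak

/-! ### Solitary waves -/

/-- A nonconstant decaying solution `z < 1` of the normalized equation, critical at the origin. With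
`κ = k / (c - k)` it corresponds to the solitary wave `k + (c - k) * z`. -/
structure IsNormalizedWave (b κ : ℝ) (z : ℝ → ℝ) : Prop where
  differentiable : Differentiable ℝ z
  hasDerivAt_deriv : ∀ x, HasDerivAt (deriv z) (z x - κ * force b (z x)) x
  lt_one : ∀ x, z x < 1
  deriv_zero : deriv z 0 = 0
  tendsto_atTop : Tendsto z atTop (𝓝 0)
  tendsto_atBot : Tendsto z atBot (𝓝 0)
  exists_ne_zero : ∃ x, z x ≠ 0

/-- The momentum density `φ - φ''` times `(c - φ) ^ b`, which is conserved along travelling waves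
below the speed `c`. -/
def momentum (b c : ℝ) (φ : ℝ → ℝ) (x : ℝ) : ℝ := (φ x - iteratedDeriv 2 φ x) * (c - φ x) ^ b

/-- The level of `ratio b` above `ratio b 0 = b` reached by the solitary wave on the background
`k`. -/
def amplitude (b c k : ℝ) : ℝ := (c - k) / k - b

section NormalizedWave

variable {b κ Y : ℝ} {z z₁ z₂ : ℝ → ℝ}

theorem contDiffAt_sub_mul_force {n : WithTop ℕ∞} (b κ : ℝ) {z : ℝ} (hz : z < 1) :
    ContDiffAt ℝ n (fun z => z - κ * force b z) z :=
  (analyticAt_id.sub (analyticAt_const.mul (analyticAt_force b hz))).contDiffAt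

namespace IsNormalizedWave

theorem contDiff (hz : IsNormalizedWave b κ z) : ContDiff ℝ ∞ z :=
  contDiff_of_hasDerivAt_second_order (g := fun z => z - κ * force b z)
    (fun x => contDiffAt_sub_mul_force b κ (hz.lt_one x))
    (fun x => (hz.differentiable x).hasDerivAt) hz.hasDerivAt_deriv

theorem ext (h₁ : IsNormalizedWave b κ z₁) (h₂ : IsNormalizedWave b κ z₂) (h : z₁ 0 = z₂ 0) :
    z₁ = z₂ :=
  eq_of_hasDerivAt_second_order (g := fun z => z - κ * force b z)
    (fun x => contDiffAt_sub_mul_force b κ (h₁.lt_one x))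
    (fun x => (h₁.differentiable x).hasDerivAt) h₁.hasDerivAt_deriv
    (fun x => (h₂.differentiable x).hasDerivAt) h₂.hasDerivAt_deriv h
    (h₁.deriv_zero.trans h₂.deriv_zero.symm)

theorem apply_zero_ne_zero (hz : IsNormalizedWave b κ z) : z 0 ≠ 0 := fun h0 => by
  obtain ⟨x, hx⟩ := hz.exists_ne_zero
  have hzero : z = fun _ => 0 :=
    eq_of_hasDerivAt_second_order (g := fun z => z - κ * force b z) (w₂ := fun _ => 0)
      (fun x => contDiffAt_sub_mul_force b κ (hz.lt_one x))
      (fun x => (hz.differentiable x).hasDerivAt) hz.hasDerivAt_deriv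
      (fun x => hasDerivAt_const x 0)
      (fun x => by simpa [force_zero] using hasDerivAt_const x (0 : ℝ)) h0 hz.deriv_zero
  exact hx (congrFun hzero x)

theorem sq_deriv (hb : b ≠ 1) (hz : IsNormalizedWave b κ z) (x : ℝ) :
    deriv z x ^ 2 = z x ^ 2 * (1 - κ * ratio b (z x)) := by
  have hV : ∀ y < 1, HasDerivAt (fun z => z ^ 2 / 2 - κ * pot b z) (y - κ * force b y) y := by
    intro y hy
    convert! ((hasDerivAt_pow 2 y).div_const 2).sub ((hasDerivAt_pot hb hy).const_mul κ) using 1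
    ring
  have henergy := sq_deriv_eq_of_tendsto (g := fun z => z - κ * force b z)
    (fun x => (hz.differentiable x).hasDerivAt)
    hz.hasDerivAt_deriv (fun x => hV (z x) (hz.lt_one x)) (hV 0 one_pos).continuousAt
    hz.tendsto_atTop x
  rw [pot_zero] at henergy
  linear_combination henergy + κ * sq_mul_ratio hb (z x)

theorem apply_zero (hb : 1 < b) (hY : 0 < Y) (hz : IsNormalizedWave b (b + Y)⁻¹ z) :
    z 0 = ratioInv (ratio b) Y := by
  have hH := isHomoclinicRatio_ratio hb
  have hsum : b + Y ≠ 0 := by positivity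
  have henergy := hz.sq_deriv hb.ne' 0
  rw [hz.deriv_zero, zero_pow two_ne_zero] at henergy
  have hturn : 1 - (b + Y)⁻¹ * ratio b (z 0) = 0 :=
    (mul_eq_zero.1 henergy.symm).resolve_left (pow_ne_zero 2 hz.apply_zero_ne_zero)
  have hratio : ratio b (z 0) = b + Y := by
    field_simp at hturn
    linarith
  have hpos : 0 < z 0 := by
    by_contra! hneg
    linarith [ratio_le hb hneg]
  refine hH.strictMonoOn.injOn ⟨hpos.le, hz.lt_one 0⟩
    (Ioo_subset_Ico_self (hH.ratioInv_mem hY)) ?_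
  rw [hratio, hH.apply_ratioInv hY, ratio_zero hb.ne']

end IsNormalizedWave

theorem isNormalizedWave_profile (hb : 1 < b) (hY : 0 < Y) :
    IsNormalizedWave b (b + Y)⁻¹ (profile (ratio b) Y) := by
  have hH := isHomoclinicRatio_ratio hb
  have hderiv := funext fun x => (hH.hasDerivAt_profile hY x).deriv
  exact {
    differentiable x := (hH.hasDerivAt_profile hY x).differentiableAt
    hasDerivAt_deriv x := by
      rw [hderiv, force_eq_ratio hb.ne' (hH.profile_mem hY x).2, ← ratio_zero hb.ne']
      simpa only [ratio_zero hb.ne'] using hH.hasDerivAt_deriv_profile hY x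
    lt_one x := (hH.profile_mem hY x).2
    deriv_zero := by simp [hderiv, hH.parameter_zero hY]
    tendsto_atTop := hH.tendsto_profile_atTop hY
    tendsto_atBot := hH.tendsto_profile_atBot hY
    exists_ne_zero := ⟨0, (hH.profile_mem hY 0).1.ne'⟩ }

theorem isNormalizedWave_iff (hb : 1 < b) (hY : 0 < Y) :
    IsNormalizedWave b (b + Y)⁻¹ z ↔ z = profile (ratio b) Y := by
  refine ⟨fun hz => hz.ext (isNormalizedWave_profile hb hY) ?_, ?_⟩
  · rw [hz.apply_zero hb hY, (isHomoclinicRatio_ratio hb).profile_zero hY]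
  · rintro rfl
    exact isNormalizedWave_profile hb hY

end NormalizedWave

section SolitaryWave

variable {b c k s x : ℝ} {φ z : ℝ → ℝ}

theorem iteratedDeriv_two_eq_sub_momentum (φ : ℝ → ℝ) (hx : φ x < c) :
    iteratedDeriv 2 φ x = φ x - momentum b c φ x * (c - φ x) ^ (-b) := by
  have hpos : 0 < c - φ x := sub_pos.2 hx
  have hpow := (Real.rpow_pos_of_pos hpos b).ne'
  rw [momentum, Real.rpow_neg hpos.le]
  field_simp
  ring

namespace IsSolitaryWave

theorem hasDerivAt_iteratedDeriv (h : IsSolitaryWave b c k φ) (n : ℕ) (x : ℝ) :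
    HasDerivAt (iteratedDeriv n φ) (iteratedDeriv (n + 1) φ x) x := by
  rw [iteratedDeriv_succ]
  exact (h.smooth.differentiable_iteratedDeriv n (mod_cast ENat.natCast_lt_top n) x).hasDerivAt

theorem hasDerivAt (h : IsSolitaryWave b c k φ) (x : ℝ) : HasDerivAt φ (deriv φ x) x := by
  simpa using h.hasDerivAt_iteratedDeriv 0 x

theorem hasDerivAt_deriv (h : IsSolitaryWave b c k φ) (x : ℝ) :
    HasDerivAt (deriv φ) (iteratedDeriv 2 φ x) x := by
  simpa using h.hasDerivAt_iteratedDeriv 1 x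

theorem hasDerivAt_momentum (h : IsSolitaryWave b c k φ) (hx : φ x < c) :
    HasDerivAt (momentum b c φ) 0 x := by
  have hpos : 0 < c - φ x := sub_pos.2 hx
  have hpow : (c - φ x) ^ b = (c - φ x) ^ (b - 1) * (c - φ x) := by
    rw [Real.rpow_sub_one hpos.ne']
    field_simp
  convert! ((h.hasDerivAt x).sub (h.hasDerivAt_iteratedDeriv 2 x)).mul
    (((h.hasDerivAt x).const_sub c).rpow_const (p := b) (Or.inl hpos.ne')) using 1
  simp only [Pi.sub_apply, hpow]
  linear_combination -(c - φ x) ^ (b - 1) * h.ode x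

theorem momentum_eq_of_Ioi (hkc : k < c) (h : IsSolitaryWave b c k φ) (hs : ∀ y, s < y → φ y < c)
    (hx : s < x) : momentum b c φ x = k * (c - k) ^ b := by
  have hck : 0 < c - k := sub_pos.2 hkc
  have hconst : ∀ y, s < y → momentum b c φ y = momentum b c φ x := fun y hy =>
    isOpen_Ioi.is_const_of_deriv_eq_zero isPreconnected_Ioi
      (fun t ht => (h.hasDerivAt_momentum (hs t ht)).differentiableAt.differentiableWithinAt)
      (fun t ht => (h.hasDerivAt_momentum (hs t ht)).deriv) hy hx
  have hlim : Tendsto (iteratedDeriv 2 φ) atTop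
      (𝓝 (k - momentum b c φ x * (c - k) ^ (-b))) := by
    refine (h.tendsto_atTop.sub (((h.tendsto_atTop.const_sub c).rpow_const
      (Or.inl hck.ne')).const_mul (momentum b c φ x))).congr' ?_
    filter_upwards [eventually_gt_atTop s] with y hy
    rw [iteratedDeriv_two_eq_sub_momentum φ (hs y hy), hconst y hy]
  have hzero := second_deriv_limit_eq_zero h.hasDerivAt h.hasDerivAt_deriv h.tendsto_atTop hlim
  have hpow := (Real.rpow_pos_of_pos hck b).ne'
  rw [Real.rpow_neg hck.le] at hzero
  field_simp at hzero
  linarith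

theorem continuous_momentum (hb : 0 ≤ b) (h : IsSolitaryWave b c k φ) :
    Continuous (momentum b c φ) := by
  have hcont := h.smooth.continuous
  refine (hcont.sub ?_).mul ((continuous_const.sub hcont).rpow_const fun _ => Or.inr hb)
  exact continuous_iff_continuousAt.2 fun x => (h.hasDerivAt_iteratedDeriv 2 x).continuousAt

-- At the last point where `φ` touches `c` the momentum would vanish, while it equals the positive
-- constant `k * (c - k) ^ b` to the right of that point.
theorem lt_speed (hb : 0 < b) (hk : 0 < k) (hkc : k < c) (h : IsSolitaryWave b c k φ) (x : ℝ) :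
    φ x < c := by
  by_contra! hx
  have hcont := h.smooth.continuous
  have hbdd : BddAbove {x | c ≤ φ x} := by
    obtain ⟨y, hy⟩ := eventually_atTop.1 (h.tendsto_atTop.eventually (gt_mem_nhds hkc))
    exact ⟨y, fun t ht => le_of_not_gt fun hyt => (hy t hyt.le).not_ge ht⟩
  set s := sSup {x | c ≤ φ x}
  have hmem : c ≤ φ s := (isClosed_le continuous_const hcont).csSup_mem ⟨x, hx⟩ hbdd
  have hlt : ∀ y, s < y → φ y < c := fun y hy => lt_of_not_ge fun hc =>
    (le_csSup hbdd hc).not_gt hy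
  have htouch : φ s = c := by
    refine le_antisymm (le_of_tendsto (hcont.continuousWithinAt (s := Ioi s)) ?_) hmem
    exact eventually_mem_nhdsWithin.mono fun y hy => (hlt y hy).le
  have hlim : momentum b c φ s = k * (c - k) ^ b := by
    refine tendsto_nhds_unique_of_eventuallyEq
      ((h.continuous_momentum hb.le).continuousWithinAt (s := Ioi s)) tendsto_const_nhds ?_
    exact eventually_mem_nhdsWithin.mono fun y hy => h.momentum_eq_of_Ioi hkc hlt hy
  rw [momentum, htouch, sub_self, Real.zero_rpow hb.ne', mul_zero] at hlim
  exact (mul_pos hk (Real.rpow_pos_of_pos (sub_pos.2 hkc) b)).ne hlim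

theorem iteratedDeriv_two_eq (hb : 0 < b) (hk : 0 < k) (hkc : k < c) (h : IsSolitaryWave b c k φ)
    (x : ℝ) : iteratedDeriv 2 φ x = φ x - k * (1 - (φ x - k) / (c - k)) ^ (-b) := by
  have hlt := h.lt_speed hb hk hkc
  have hck : 0 < c - k := sub_pos.2 hkc
  have hpos : 0 < c - φ x := sub_pos.2 (hlt x)
  have hmomentum := h.momentum_eq_of_Ioi hkc (fun y _ => hlt y) (sub_one_lt x)
  have hpow := (Real.rpow_pos_of_pos hck b).ne'
  have hquot : 1 - (φ x - k) / (c - k) = (c - φ x) / (c - k) := by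
    field_simp
    ring
  rw [iteratedDeriv_two_eq_sub_momentum φ (hlt x), hmomentum, hquot,
    Real.div_rpow hpos.le hck.le, Real.rpow_neg hck.le]
  field_simp

theorem isNormalizedWave (hb : 0 < b) (hk : 0 < k) (hkc : k < c) (h : IsSolitaryWave b c k φ) :
    IsNormalizedWave b (k / (c - k)) fun x => (φ x - k) / (c - k) := by
  have hck : 0 < c - k := sub_pos.2 hkc
  have hz : ∀ x, HasDerivAt (fun x => (φ x - k) / (c - k)) (deriv φ x / (c - k)) x := fun x =>
    ((h.hasDerivAt x).sub_const k).div_const (c - k)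
  have hderiv := funext fun x => (hz x).deriv
  exact {
    differentiable x := (hz x).differentiableAt
    hasDerivAt_deriv x := by
      rw [hderiv]
      convert! (h.hasDerivAt_deriv x).div_const (c - k) using 1
      rw [h.iteratedDeriv_two_eq hb hk hkc, force]
      field_simp
      ring
    lt_one x := (div_lt_one hck).2 (sub_lt_sub_right (h.lt_speed hb hk hkc x) k)
    deriv_zero := by simp [h.centred]
    tendsto_atTop := by simpa using (h.tendsto_atTop.sub_const k).div_const (c - k)
    tendsto_atBot := by simpa using (h.tendsto_atBot.sub_const k).div_const (c - k)
    exists_ne_zero := h.nonconstant.imp fun x hx => div_ne_zero (sub_ne_zero.2 hx) hck.ne' }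

end IsSolitaryWave

theorem IsNormalizedWave.isSolitaryWave (hkc : k ≠ c) (hz : IsNormalizedWave b (k / (c - k)) z) :
    IsSolitaryWave b c k fun x => k + (c - k) * z x := by
  have hck : c - k ≠ 0 := sub_ne_zero.2 hkc.symm
  have hz' : ∀ x, HasDerivAt z (deriv z x) x := fun x => (hz.differentiable x).hasDerivAt
  have hφ : ∀ x, HasDerivAt (fun x => k + (c - k) * z x) ((c - k) * deriv z x) x := fun x =>
    ((hz' x).const_mul (c - k)).const_add k
  have hφ' : ∀ x, HasDerivAt (fun x => (c - k) * deriv z x)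
      ((c - k) * (z x - k / (c - k) * force b (z x))) x := fun x =>
    (hz.hasDerivAt_deriv x).const_mul (c - k)
  have hφ'' : ∀ x, HasDerivAt (fun x => (c - k) * (z x - k / (c - k) * force b (z x)))
      ((c - k) * (deriv z x - k / (c - k) * (b * (1 - z x) ^ (-b - 1) * deriv z x))) x :=
    fun x => ((hz' x).sub (((hasDerivAt_force b (hz.lt_one x)).comp x (hz' x)).const_mul
      (k / (c - k)))).const_mul (c - k)
  have hderiv := funext fun x => (hφ x).deriv
  have hderiv' := funext fun x => (hφ' x).deriv
  exact {
    smooth := contDiff_const.add (contDiff_const.mul hz.contDiff)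
    ode x := by
      have hpos : 1 - z x ≠ 0 := (sub_pos.2 (hz.lt_one x)).ne'
      rw [iteratedDeriv_succ, iteratedDeriv_succ, iteratedDeriv_one, hderiv, hderiv',
        (hφ'' x).deriv, Real.rpow_sub_one hpos]
      simp only [force]
      field_simp
      ring
    centred := by simp [hderiv, hz.deriv_zero]
    tendsto_atTop := by simpa using (hz.tendsto_atTop.const_mul (c - k)).const_add k
    tendsto_atBot := by simpa using (hz.tendsto_atBot.const_mul (c - k)).const_add k
    nonconstant := hz.exists_ne_zero.imp fun x hx => by simp [hck, hx] }

theorem background_lt (hb : 0 < b) (hk : k ∈ Ioo 0 (c / (b + 1))) : k < c := by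
  have hlt : k * (b + 1) < c := (lt_div_iff₀ (by linarith)).1 hk.2
  nlinarith [mul_pos hk.1 hb]

theorem amplitude_pos (hb : 0 < b) (hk : k ∈ Ioo 0 (c / (b + 1))) : 0 < amplitude b c k := by
  have hlt : k * (b + 1) < c := (lt_div_iff₀ (by linarith)).1 hk.2
  rw [amplitude, sub_pos, lt_div_iff₀ hk.1]
  linarith

theorem inv_add_amplitude (b c k : ℝ) : (b + amplitude b c k)⁻¹ = k / (c - k) := by
  rw [amplitude, add_sub_cancel, inv_div]

theorem isSolitaryWave_iff (hb : 1 < b) (hk : k ∈ Ioo 0 (c / (b + 1))) :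
    IsSolitaryWave b c k φ ↔ φ = fun x => k + (c - k) * profile (ratio b) (amplitude b c k) x := by
  have hb0 : 0 < b := one_pos.trans hb
  have hkc := background_lt hb0 hk
  have hnormal := fun z => isNormalizedWave_iff (z := z) hb (amplitude_pos hb0 hk)
  simp only [inv_add_amplitude] at hnormal
  constructor
  · intro h
    rw [← (hnormal _).1 (h.isNormalizedWave hb0 hk.1 hkc)]
    have hck : c - k ≠ 0 := (sub_pos.2 hkc).ne'
    ext x
    field_simp
    ring
  · rintro rfl
    exact ((hnormal _).2 rfl).isSolitaryWave hkc.ne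

theorem existsUnique_isSolitaryWave (hb : 1 < b) (hk : k ∈ Ioo 0 (c / (b + 1))) :
    ∃! φ : ℝ → ℝ, IsSolitaryWave b c k φ := by
  simp only [isSolitaryWave_iff hb hk, existsUnique_eq]

theorem solitaryWave_eq (hb : 1 < b) (hk : k ∈ Ioo 0 (c / (b + 1))) :
    solitaryWave b c k = fun x => k + (c - k) * profile (ratio b) (amplitude b c k) x :=
  (isSolitaryWave_iff hb hk).1 (Classical.epsilon_spec (existsUnique_isSolitaryWave hb hk).exists)

theorem solitaryWave_mem (hb : 1 < b) (hk : k ∈ Ioo 0 (c / (b + 1))) (x : ℝ) :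
    solitaryWave b c k x ∈ Ioo k c := by
  have hb0 : 0 < b := one_pos.trans hb
  have hck : 0 < c - k := sub_pos.2 (background_lt hb0 hk)
  have hz := (isHomoclinicRatio_ratio hb).profile_mem (amplitude_pos hb0 hk) x
  rw [solitaryWave_eq hb hk]
  exact ⟨lt_add_of_pos_right k (mul_pos hck hz.1), by linarith [mul_lt_of_lt_one_right hck hz.2]⟩

theorem densityQ_eq_neg_dens (hkc : k ≠ c) (hz : z x < 1) :
    densityQ b c k (fun x => k + (c - k) * z x) x = -dens b (z x) := by
  have hck : c - k ≠ 0 := sub_ne_zero.2 hkc.symm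
  have hpos : 0 < 1 - z x := sub_pos.2 hz
  have hquot : (c - k) / (c - (k + (c - k) * z x)) = (1 - z x)⁻¹ := by
    rw [show c - (k + (c - k) * z x) = (c - k) * (1 - z x) by ring]
    field_simp
  rw [densityQ, dens, hquot, Real.inv_rpow hpos.le, Real.rpow_neg hpos.le, Real.rpow_neg_one]
  ring

theorem densityQ_solitaryWave (hb : 1 < b) (hk : k ∈ Ioo 0 (c / (b + 1))) :
    densityQ b c k (solitaryWave b c k) = fun x =>
      -(fun z => z * deriv (ratio b) z * weight b z) (profile (ratio b) (amplitude b c k) x) := by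
  have hb0 : 0 < b := one_pos.trans hb
  ext x
  have hz := (isHomoclinicRatio_ratio hb).profile_mem (amplitude_pos hb0 hk) x
  rw [solitaryWave_eq hb hk, densityQ_eq_neg_dens (background_lt hb0 hk).ne hz.2,
    dens_eq_weight hb (Ioo_subset_Ico_self hz)]

theorem integrable_densityQ_solitaryWave (hb : 1 < b) (hk : k ∈ Ioo 0 (c / (b + 1))) :
    Integrable (densityQ b c k (solitaryWave b c k)) := by
  rw [densityQ_solitaryWave hb hk]
  exact ((isHomoclinicRatio_ratio hb).integrable_comp_profile
    (amplitude_pos (one_pos.trans hb) hk)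
    fun z hz => (analyticAt_weight hb hz).continuousAt.continuousWithinAt).neg

theorem mapQ_eq_neg_profileIntegral (hb : 1 < b) (hk : k ∈ Ioo 0 (c / (b + 1))) :
    mapQ b c k = -profileIntegral (ratio b) (weight b) (amplitude b c k) := by
  rw [mapQ, densityQ_solitaryWave hb hk, integral_neg,
    (isHomoclinicRatio_ratio hb).integral_comp_profile (amplitude_pos (one_pos.trans hb) hk)]

end SolitaryWave

/-! ### Dependence on the normalized parameter -/

section NormalizedParameter

variable {b c p q γ : ℝ} {s : Set ℝ}

theorem amplitude_kOf (hc : c ≠ 0) (hγ : γ ≠ 1) (hbγ : b + 1 - γ ≠ 0) :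
    amplitude b c (kOf b c γ) = b * γ / (1 - γ) := by
  have hγ' : 1 - γ ≠ 0 := sub_ne_zero.2 hγ.symm
  rw [amplitude, kOf]
  field_simp
  ring

theorem mapQ_kOf (hb : 1 < b) (hc : 0 < c) (hγ : γ ∈ Ioo (0 : ℝ) 1) :
    mapQ b c (kOf b c γ) = -profileIntegral (ratio b) (weight b) (b * γ / (1 - γ)) := by
  rw [mapQ_eq_neg_profileIntegral hb (gammaOf_kOf hb hc hγ).1,
    amplitude_kOf hc.ne' hγ.2.ne (by linarith [hγ.2])]

theorem exists_hasDerivAt_mapQ_kOf (hb : 1 < b) (hc : 0 < c) (hγ : γ ∈ Ioo (0 : ℝ) 1)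
    (hderiv : ∃ d > 0, HasDerivAt (profileIntegral (ratio b) (weight b)) d (b * γ / (1 - γ))) :
    ∃ d < 0, HasDerivAt (fun γ => mapQ b c (kOf b c γ)) d γ := by
  obtain ⟨d, hd, hintegral⟩ := hderiv
  have hγ' : 0 < 1 - γ := sub_pos.2 hγ.2
  have hamplitude : HasDerivAt (fun γ : ℝ => b * γ / (1 - γ)) (b / (1 - γ) ^ 2) γ := by
    convert! ((hasDerivAt_id γ).const_mul b).div ((hasDerivAt_id γ).const_sub 1) hγ'.ne' using 1
    simp
    ring
  refine ⟨-(d * (b / (1 - γ) ^ 2)), neg_neg_of_pos (by positivity), ?_⟩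
  refine (hintegral.comp γ hamplitude).neg.congr_of_eventuallyEq ?_
  filter_upwards [Ioo_mem_nhds hγ.1 hγ.2] with x hx using mapQ_kOf hb hc hx

theorem tendsto_mul_div_one_sub_nhdsGT (hb : 0 < b) :
    Tendsto (fun γ : ℝ => b * γ / (1 - γ)) (𝓝[>] 0) (𝓝[>] 0) := by
  refine tendsto_nhdsWithin_iff.2 ⟨?_, ?_⟩
  · have hcont : ContinuousAt (fun γ : ℝ => b * γ / (1 - γ)) 0 :=
      ContinuousAt.div (by fun_prop) (by fun_prop) (by norm_num)
    simpa using hcont.tendsto.mono_left nhdsWithin_le_nhds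
  · filter_upwards [Ioo_mem_nhdsGT one_pos] with γ hγ
    exact div_pos (mul_pos hb hγ.1) (sub_pos.2 hγ.2)

theorem tendsto_mul_div_one_sub_nhdsLT (hb : 0 < b) :
    Tendsto (fun γ : ℝ => b * γ / (1 - γ)) (𝓝[<] 1) atTop := by
  have hnum : Tendsto (fun γ : ℝ => b * γ) (𝓝[<] 1) (𝓝 (b * 1)) :=
    ((continuous_const_mul b).tendsto 1).mono_left nhdsWithin_le_nhds
  exact Tendsto.pos_mul_atTop (by rwa [mul_one]) hnum
    (tendsto_inv_nhdsGT_zero.comp tendsto_one_sub_nhdsLT)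

theorem eventually_exists_hasDerivAt_mapQ_kOf_nhdsGT (hb : 1 < b) (hc : 0 < c) :
    ∀ᶠ γ in 𝓝[>] (0 : ℝ), ∃ d < 0, HasDerivAt (fun γ => mapQ b c (kOf b c γ)) d γ := by
  have hderiv := (isHomoclinicRatio_ratio hb).eventually_exists_hasDerivAt_profileIntegral_nhdsGT
    (fun z hz => (analyticAt_weight hb hz).contDiffAt) (fun z hz => weight_pos hb hz)
    (eventually_deriv_weight_pos hb)
  filter_upwards [(tendsto_mul_div_one_sub_nhdsGT (one_pos.trans hb)).eventually hderiv,
    Ioo_mem_nhdsGT one_pos] with γ hγ hmem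
  exact exists_hasDerivAt_mapQ_kOf hb hc hmem hγ

theorem eventually_exists_hasDerivAt_mapQ_kOf_nhdsLT (hb : 1 < b) (hc : 0 < c) :
    ∀ᶠ γ in 𝓝[<] (1 : ℝ), ∃ d < 0, HasDerivAt (fun γ => mapQ b c (kOf b c γ)) d γ := by
  have hderiv := (isHomoclinicRatio_ratio hb).eventually_exists_hasDerivAt_profileIntegral_atTop
    (fun z hz => (analyticAt_weight hb hz).contDiffAt) one_half_pos (tendsto_weight_nhdsLT hb)
    (tendsto_logSlope_weight_nhdsLT hb)
  filter_upwards [(tendsto_mul_div_one_sub_nhdsLT (one_pos.trans hb)).eventually hderiv,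
    Ioo_mem_nhdsLT one_pos] with γ hγ hmem
  exact exists_hasDerivAt_mapQ_kOf hb hc hmem hγ

theorem tendsto_mapQ_kOf_nhdsLT (hb : 1 < b) (hc : 0 < c) :
    Tendsto (fun γ => mapQ b c (kOf b c γ)) (𝓝[<] (1 : ℝ)) atBot := by
  have hatTop := (isHomoclinicRatio_ratio hb).tendsto_profileIntegral_atTop
    (fun z hz => (analyticAt_weight hb hz).continuousAt.continuousWithinAt) one_half_pos
    (tendsto_weight_nhdsLT hb)
  refine (tendsto_neg_atTop_atBot.comp
    (hatTop.comp (tendsto_mul_div_one_sub_nhdsLT (one_pos.trans hb)))).congr' ?_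
  filter_upwards [Ioo_mem_nhdsLT one_pos] with γ hγ using (mapQ_kOf hb hc hγ).symm

theorem strictAntiOn_gammaOf (hb : 0 < b) (hc : 0 < c) :
    StrictAntiOn (gammaOf b c) (Ioo 0 (c / (b + 1))) := by
  intro x hx y hy hxy
  have hxc := background_lt hb hx
  have hyc := background_lt hb hy
  rw [gammaOf, gammaOf, div_lt_div_iff₀ (by linarith) (by linarith)]
  linarith [mul_pos (mul_pos hb hc) (sub_pos.2 hxy)]

theorem strictMonoOn_mapQ (hb : 1 < b) (hc : 0 < c) (hs : s ⊆ Ioo 0 (c / (b + 1)))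
    (hmaps : MapsTo (gammaOf b c) s (Ioo p q))
    (hderiv : ∀ γ ∈ Ioo p q, ∃ d < 0, HasDerivAt (fun γ => mapQ b c (kOf b c γ)) d γ) :
    StrictMonoOn (mapQ b c) s := by
  choose! d hneg hd using hderiv
  have hanti : StrictAntiOn (fun γ => mapQ b c (kOf b c γ)) (Ioo p q) :=
    strictAntiOn_of_hasDerivWithinAt_neg (convex_Ioo p q) (HasDerivAt.continuousOn hd)
      (fun γ hγ => (hd γ (interior_subset hγ)).hasDerivWithinAt)
      fun γ hγ => hneg γ (interior_subset hγ)
  refine (hanti.comp ((strictAntiOn_gammaOf (one_pos.trans hb) hc).mono hs) hmaps).congr ?_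
  exact fun k hk => congrArg (mapQ b c) (kOf_gammaOf hb hc (hs hk)).2

theorem exists_strictMonoOn_mapQ_left (hb : 1 < b) (hc : 0 < c) :
    ∃ δ ∈ Ioo 0 (c / (b + 1)), StrictMonoOn (mapQ b c) (Ioo 0 δ) := by
  obtain ⟨p, hp, hsub⟩ := (mem_nhdsLT_iff_exists_Ioo_subset' one_pos).1
    ((eventually_exists_hasDerivAt_mapQ_kOf_nhdsLT hb hc).and (Ioo_mem_nhdsLT one_pos))
  obtain ⟨γ, hγ⟩ := exists_between (mem_Iio.1 hp)
  obtain ⟨hδ, hγδ⟩ := gammaOf_kOf hb hc (hsub hγ).2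
  have hs : Ioo 0 (kOf b c γ) ⊆ Ioo 0 (c / (b + 1)) := Ioo_subset_Ioo_right hδ.2.le
  refine ⟨_, hδ, strictMonoOn_mapQ hb hc hs (fun k hk => ⟨?_, ?_⟩) fun γ hγ => (hsub hγ).1⟩
  · have hlt := strictAntiOn_gammaOf (one_pos.trans hb) hc (hs hk) hδ hk.2
    exact hγ.1.trans (hγδ ▸ hlt)
  · exact (kOf_gammaOf hb hc (hs hk)).1.2

theorem exists_strictMonoOn_mapQ_right (hb : 1 < b) (hc : 0 < c) :
    ∃ δ ∈ Ioo 0 (c / (b + 1)), StrictMonoOn (mapQ b c) (Ioo δ (c / (b + 1))) := by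
  obtain ⟨q, hq, hsub⟩ := (mem_nhdsGT_iff_exists_Ioo_subset' one_pos).1
    ((eventually_exists_hasDerivAt_mapQ_kOf_nhdsGT hb hc).and (Ioo_mem_nhdsGT one_pos))
  obtain ⟨γ, hγ⟩ := exists_between (mem_Ioi.1 hq)
  obtain ⟨hδ, hγδ⟩ := gammaOf_kOf hb hc (hsub hγ).2
  have hs : Ioo (kOf b c γ) (c / (b + 1)) ⊆ Ioo 0 (c / (b + 1)) := Ioo_subset_Ioo_left hδ.1.le
  refine ⟨_, hδ, strictMonoOn_mapQ hb hc hs (fun k hk => ⟨?_, ?_⟩) fun γ hγ => (hsub hγ).1⟩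
  · exact (kOf_gammaOf hb hc (hs hk)).1.1
  · have hlt := strictAntiOn_gammaOf (one_pos.trans hb) hc hδ (hs hk) hk.1
    exact (hγδ ▸ hlt).trans hγ.2

end NormalizedParameter

end

theorem lemma7 (b c : ℝ) (hb : 1 < b) (hc : 0 < c) :
    (∀ k ∈ Ioo 0 (c / (b + 1)),
      (∃! φ : ℝ → ℝ, IsSolitaryWave b c k φ) ∧
      (∀ x, 0 < solitaryWave b c k x ∧ solitaryWave b c k x < c) ∧
      Integrable (densityQ b c k (solitaryWave b c k))) ∧
    (∃ δ ∈ Ioo 0 (c / (b + 1)), StrictMonoOn (mapQ b c) (Ioo 0 δ)) ∧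
    (∃ δ ∈ Ioo 0 (c / (b + 1)), StrictMonoOn (mapQ b c) (Ioo δ (c / (b + 1)))) ∧
    (∀ᶠ γ in 𝓝[>] (0 : ℝ), ∃ d < 0, HasDerivAt (fun γ => mapQ b c (kOf b c γ)) d γ) ∧
    (∀ᶠ γ in 𝓝[<] (1 : ℝ), ∃ d < 0, HasDerivAt (fun γ => mapQ b c (kOf b c γ)) d γ) ∧
    Tendsto (fun γ => mapQ b c (kOf b c γ)) (𝓝[<] (1 : ℝ)) atBot := by
  refine ⟨fun k hk => ⟨existsUnique_isSolitaryWave hb hk, fun x => ?_,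
      integrable_densityQ_solitaryWave hb hk⟩,
    exists_strictMonoOn_mapQ_left hb hc, exists_strictMonoOn_mapQ_right hb hc,
    eventually_exists_hasDerivAt_mapQ_kOf_nhdsGT hb hc,
    eventually_exists_hasDerivAt_mapQ_kOf_nhdsLT hb hc, tendsto_mapQ_kOf_nhdsLT hb hc⟩
  exact ⟨hk.1.trans (solitaryWave_mem hb hk x).1, (solitaryWave_mem hb hk x).2⟩
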